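/- **Setting.** For every $N\ge 1$ let $(R,Y,\mathbf X)=(R_N,Y_N,\mathbf X_N)$ be a random triple with $R\in\{0,1\}$, $Y\in\mathbb R$, $\mathbf X\in\mathbb R^{p_N}$, whose law and whose dimension $p_N$ may depend on $N$. Put $\theta_0=\mathbb E(Y)$, $m(\mathbf X)=\mathbb E(Y\mid\mathbf X)$, $\pi_N(\mathbf X)=\mathbb E(R\mid\mathbf X)$ (a known function) and $a_N^{-1}=\mathbb E\{\pi_N^{-1}(\mathbf X)\}\in[1,\infty]$. Let $\mathbf Z_i=(R_i,R_iY_i,\mathbf X_i)$, $i\le N$, be observed, where $(R_i,Y_i,\mathbf X_i)$, $i\le N$, are i.i.d. copies of $(R,Y,\mathbf X)$. Fix $\mathbb K\ge2$ and let $\mathcal I_1,\dots,\mathcal I_{\mathbb K}$ be a random partition of $\{1,\dots,N\}$, independent of the data. For $k\le\mathbb K$ let $\widehat m(\cdot;\mathbb S_{-k})$ be a (jointly measurable) function of the training data $\mathbb S_{-k}=\{\mathbf Z_i:i\notin\mathcal I_k\}$ and of $\mathbf x$; for $i\in\mathcal I_k$ put $\widehat m(\mathbf X_i)=\widehat m(\mathbf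 X_i;\mathbb S_{-k})$. Let $$\tilde\theta=\frac1N\sum_{i=1}^N\widehat m(\mathbf X_i)+\frac1N\sum_{i=1}^N\frac{R_i}{\pi_N(\mathbf X_i)}\{Y_i-\widehat m(\mathbf X_i)\}.$$ Let $\mu(\cdot)=\mu_N(\cdot)$ be a measurable function on $\mathbb R^{p_N}$, not necessarily equal to $m$, and put $$\psi_{\mu,\pi}(\mathbf Z)=\mu(\mathbf X)+\frac{R}{\pi_N(\mathbf X)}\{Y-\mu(\mathbf X)\}-\theta_0,\qquad \widetilde\psi_\mu(\mathbf Z)=\frac{R}{\pi_N(\mathbf X)}\{Y-\mu(\mathbf X)\}-\mathbb E\Big[\frac{R}{\pi_N(\mathbf X)}\{Y-\mu(\mathbf X)\}\Big],$$ $V_N(\mu)=\mathrm{Var}\{\psi_{\mu,\pi}(\mathbf Z)\}$ and $\widetilde V_N(\mu)=\mathrm{Var}\{\widetilde\psi_\mu(\mathbf Z)\}$. For sequences, $u_N\asymp v_N$ means that $cv_N<u_N<Cv_N$ for all large $N$, with constants $c,C>0$. **Theorem.** Assume: 1. $R\perp Y\mid\mathbf X$; 2. $Y$ and $\mathbf X$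 have finite second moments and $\mathrm{Var}(\mathbf X)$ is positive definite; 3. there are constants $\sigma_{\zeta,1}^2>0$ and $\sigma_{\zeta,2}^2<\infty$, not depending on $N$, with $\mathbb E[\{Y-m(\mathbf X)\}^2\mid\mathbf X]\ge\sigma_{\zeta,1}^2$ and $\mathbb E[\{Y-\mu(\mathbf X)\}^2\mid\mathbf X]\le\sigma_{\zeta,2}^2$ almost surely, and $\mathrm{Var}(Y)\le\sigma_{\zeta,2}^2$; 4. $Na_N\to\infty$ as $N\to\infty$; 5. for a sequence $c_{\mu,N}\ge0$ with $c_{\mu,N}=o(1)$ and for every $k\le\mathbb K$, $$\mathbb E_{\mathbf X}\Big[\frac{a_N}{\pi_N(\mathbf X)}\{\widehat m(\mathbf X;\mathbb S_{-k})-\mu(\mathbf X)\}^2\Big]=O_p(c_{\mu,N}^2),$$ where $\mathbb E_{\mathbf X}$ integrates over a copy of $\mathbf X$ independent of the data and of the partition. Then, as $N\to\infty$, $$\tilde\theta-\theta_0=\frac1N\sum_{i=1}^N\psi_{\mu,\pi}(\mathbf Z_i)+O_p\Big(\frac{c_{\mu,N}}{\sqrt{Na_N}}\Big),\qquad V_N(\mu)\asymp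 a_N^{-1},$$ and also $$\tilde\theta-\theta_0=\frac1N\sum_{i=1}^N\widetilde\psi_\mu(\mathbf Z_i)+O_p\Big(\frac{c_{\mu,N}}{\sqrt{Na_N}}+\frac1{\sqrt N}\Big),\qquad \widetilde V_N(\mu)\asymp a_N^{-1},$$ where $\mathbb E\{\widetilde\psi_\mu(\mathbf Z)\}=0$ for all large $N$. If, in addition, $a_N\,\mathbb E[\psi_{\mu,\pi}^2(\mathbf Z)\mathbf 1\{|\psi_{\mu,\pi}(\mathbf Z)|>t\sqrt{N/a_N}\}]\to0$ for every $t>0$, then $$(Na_N)^{1/2}(\tilde\theta-\theta_0)=O_p(1),\qquad N^{1/2}V_N^{-1/2}(\mu)(\tilde\theta-\theta_0)\xrightarrow{d}\mathcal N(0,1),$$ and if moreover $a_N\to0$, then also $N^{1/2}\widetilde V_N^{-1/2}(\mu)(\tilde\theta-\theta_0)\xrightarrow{d}\mathcal N(0,1)$. Finally, if $a_N\to0$ (with or without the tail condition), then $V_N(\mu)/\widetilde V_N(\mu)=1+O(a_N)$. -/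

import Mathlib

open MeasureTheory ProbabilityTheory Filter Topology Asymptotics
open scoped ENNReal

noncomputable section

/-- A triple `(R, Y, X)` of a labelling indicator, a real outcome and a covariate vector in `ℝ^p`.
The same type holds the observed triples `(R, R * Y, X)`. -/
abbrev DataPoint (p : ℕ) : Type := Bool × ℝ × (Fin p → ℝ)

namespace DataPoint

variable {p : ℕ}

/-- The labelling indicator as a real number, `1` if labelled and `0` if not. -/
def R (z : DataPoint p) : ℝ := if z.1 then 1 else 0

/-- The outcome. -/
def Y (z : DataPoint p) : ℝ := z.2.1

/-- The covariates. -/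
def X (z : DataPoint p) : Fin p → ℝ := z.2.2

theorem measurable_X : Measurable (X : DataPoint p → Fin p → ℝ) :=
  measurable_snd.comp measurable_snd

/-- The σ-algebra generated by the covariates. -/
abbrev sigmaX (p : ℕ) : MeasurableSpace (DataPoint p) :=
  MeasurableSpace.comap (X : DataPoint p → Fin p → ℝ) inferInstance

/-- What is observed of `(R, Y, X)`: the triple `(R, R * Y, X)`. -/
def observed (z : DataPoint p) : DataPoint p := (z.1, R z * Y z, X z)

end DataPoint

open DataPoint

/-- The effective labelling rate `a`, where `a⁻¹ = E[1 / π(X)]`. The expectation is taken in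
`[0, ∞]` with `1 / 0 = ∞`, so that `a = 0` exactly when `E[1 / π(X)] = ∞`. -/
def effRate {p : ℕ} (Q : Measure (DataPoint p)) (π : (Fin p → ℝ) → ℝ) : ℝ :=
  ((∫⁻ z, (ENNReal.ofReal (π (X z)))⁻¹ ∂Q)⁻¹).toReal

/-- The target `θ₀ = E[Y]`. -/
def meanOutcome {p : ℕ} (Q : Measure (DataPoint p)) : ℝ := ∫ z, Y z ∂Q

/-- The influence function `ψ_{μ,π}(Z) = μ(X) + R / π(X) * (Y - μ(X)) - θ₀`. -/
def psi {p : ℕ} (Q : Measure (DataPoint p)) (π μ : (Fin p → ℝ) → ℝ) (z : DataPoint p) : ℝ :=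
  μ (X z) + R z / π (X z) * (Y z - μ (X z)) - meanOutcome Q

/-- The influence function that uses labelled data only,
`ψ̃_μ(Z) = R / π(X) * (Y - μ(X)) - E[R / π(X) * (Y - μ(X))]`. -/
def psiTilde {p : ℕ} (Q : Measure (DataPoint p)) (π μ : (Fin p → ℝ) → ℝ) (z : DataPoint p) : ℝ :=
  R z / π (X z) * (Y z - μ (X z)) - ∫ z', R z' / π (X z') * (Y z' - μ (X z')) ∂Q

/-- A learning method for sample size `N`: it takes a training set, i.e. a set `J` of indices and
the observations with indices in `J`, and returns a regression function. -/
abbrev Learner (p N : ℕ) : Type :=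
  (J : Finset (Fin N)) → (J → DataPoint p) → (Fin p → ℝ) → ℝ

/-- The indices outside the `k`-th fold, where `fold i` is the fold that contains `i`. -/
def trainIdx {N K : ℕ} (fold : Fin N → Fin K) (k : Fin K) : Finset (Fin N) :=
  Finset.univ.filter fun i => fold i ≠ k

/-- The estimator `m̂(· ; S_{-k})` trained on the observations outside the `k`-th fold. -/
def mhatOut {p N K : ℕ} (mhat : Learner p N) (fold : Fin N → Fin K) (z : Fin N → DataPoint p)
    (k : Fin K) : (Fin p → ℝ) → ℝ :=
  mhat (trainIdx fold k) fun j => observed (z j)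

/-- The cross-fitted doubly robust estimator `θ̃` with known propensity score `π`. -/
def thetaTilde {p N K : ℕ} (π : (Fin p → ℝ) → ℝ) (mhat : Learner p N) (fold : Fin N → Fin K)
    (z : Fin N → DataPoint p) : ℝ :=
  (N : ℝ)⁻¹ * ∑ i, mhatOut mhat fold z (fold i) (X (z i)) +
    (N : ℝ)⁻¹ * ∑ i, R (z i) / π (X (z i)) *
      (Y (z i) - mhatOut mhat fold z (fold i) (X (z i)))

/-- `W_N = O_p(r_N)` for `[0, ∞]`-valued random variables `W_N` and rates `r_N ≥ 0`. A real random
variable enters through its absolute value `‖·‖ₑ`. -/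
def IsBigOp {Ω : ℕ → Type*} [∀ N, MeasurableSpace (Ω N)] (P : ∀ N, Measure (Ω N))
    (W : ∀ N, Ω N → ℝ≥0∞) (r : ℕ → ℝ) : Prop :=
  ∀ ε : ℝ, 0 < ε → ∃ M : ℝ, 0 < M ∧
    ∀ᶠ N in atTop, P N {ω | ENNReal.ofReal (M * r N) < W N ω} ≤ ENNReal.ofReal ε

/-- `u_N ≍ v_N`. -/
def SameOrder (u v : ℕ → ℝ) : Prop :=
  ∃ c C : ℝ, 0 < c ∧ 0 < C ∧ ∀ᶠ N in atTop, c * v N < u N ∧ u N < C * v N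

end

open DataPoint

/-!
Write `D = Y - μ(X)`. The proof rests on one pointwise identity and on one consequence of
ignorability.

*Identity.* Replacing `m̂` by `μ` in the estimator changes the `i`-th summand by
`(1 - R_i / π(X_i)) (m̂(X_i) - μ(X_i))`. Given the folds and the training data of a fold, these
variables are i.i.d. and centred over the fold, since `R / π(X)` has conditional mean one whatever
`m̂` is, and their second moment is at most `a⁻¹ E[a / π(X) (m̂(X) - μ(X))²]`. Hence the conditional
second moment of the fold's average is at most `(N a)⁻¹` times the error that is assumed to be
`O_p(c²)`, and Chebyshev's inequality gives the rate `c / √(N a)`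
(`lintegral_sq_sum_crossfit_le`, `measure_foldRemainder_le`). The training data are truncated to the
event where that error is small, so that no moment of `m̂` is needed off it.

*Ignorability.* `E[R F(Y, X)] = E[π(X) F(Y, X)]` for all measurable `F`
(`IsPropensity.map_withDensity_R_eq`). Therefore
`V = Var Y + E[D² / π(X)] - E[D²]` and `V' = E[D² / π(X)] - (E D)²`. The conditional second moment
of `D` lies between `σ₁²` and `σ₂²`, because no function of `X` predicts `Y` better than the
regression function does, so both variances lie between `σ₁² / a` and `σ₂² / a`, while `V - V'`
stays bounded. The two influence functions differ by `μ(X) - E[μ(X)]`, whose variance is bounded; this is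
the additional `1 / √N` of the second expansion.

*Normality.* With `V` of order `a⁻¹`, the tail condition is Lindeberg's condition for the array
`ψ(Z_i) / √(N V)`. Lindeberg's theorem for rows of i.i.d. variables on varying probability spaces
(`tendstoInDistribution_of_lindeberg`) follows from Lévy's continuity theorem and the second-order
expansion of the characteristic function. The remainder, divided by the standard deviation
`√(V / N)`, is `O_p(c)` and so negligible.
-/

/-! ### Stochastic order -/

/-- Chebyshev's inequality in the form used for rates `r ≥ 0`; for `r = 0` it says that `W` vanishes
almost everywhere. -/
theorem measure_rate_lt_le_of_lintegral_sq {Ω : Type*} [MeasurableSpace Ω] {P : Measure Ω}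
    {W : Ω → ℝ≥0∞} (hW : AEMeasurable W P) {B M r : ℝ} (hM : 0 < M) (hr : 0 ≤ r)
    (h : ∫⁻ ω, W ω ^ 2 ∂P ≤ ENNReal.ofReal (B * r ^ 2)) :
    P {ω | ENNReal.ofReal (M * r) < W ω} ≤ ENNReal.ofReal (B / M ^ 2) := by
  rcases hr.eq_or_lt with rfl | hr
  · have h0 : ∫⁻ ω, W ω ^ 2 ∂P = 0 := by simpa using h
    rw [lintegral_eq_zero_iff' (hW.pow_const 2)] at h0
    refine le_of_eq_of_le ?_ zero_le
    rw [← compl_compl {ω | _}]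
    change _ ∈ ae P
    filter_upwards [h0] with ω hω
    simpa using hω
  · have hMr : 0 < (M * r) ^ 2 := by positivity
    have h1 := mul_meas_ge_le_lintegral₀ (hW.pow_const 2) (ENNReal.ofReal ((M * r) ^ 2))
    have hsub : P {ω | ENNReal.ofReal (M * r) < W ω} ≤
        P {ω | ENNReal.ofReal ((M * r) ^ 2) ≤ W ω ^ 2} := by
      refine measure_mono fun ω hω => ?_
      rw [Set.mem_ofPred_eq, ENNReal.ofReal_pow (by positivity)]
      exact pow_le_pow_left' (le_of_lt hω) 2
    have h2 : ENNReal.ofReal ((M * r) ^ 2) * P {ω | ENNReal.ofReal (M * r) < W ω} ≤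
        ENNReal.ofReal ((M * r) ^ 2) * ENNReal.ofReal (B / M ^ 2) := by
      refine ((mul_le_mul_right hsub _).trans (h1.trans h)).trans (le_of_eq ?_)
      rw [← ENNReal.ofReal_mul hMr.le]
      congr 1
      field_simp
    exact (ENNReal.mul_le_mul_iff_right (ENNReal.ofReal_pos.2 hMr).ne' ENNReal.ofReal_ne_top).1 h2

namespace IsBigOp

variable {Ω : ℕ → Type*} [∀ N, MeasurableSpace (Ω N)] {P : ∀ N, Measure (Ω N)}
  {W W' : ∀ N, Ω N → ℝ≥0∞} {r r' : ℕ → ℝ}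

theorem of_lintegral_sq {B : ℝ} (hB : 0 ≤ B) (hr : ∀ N, 0 ≤ r N)
    (hW : ∀ᶠ N in atTop, AEMeasurable (W N) (P N))
    (h : ∀ᶠ N in atTop, ∫⁻ ω, W N ω ^ 2 ∂(P N) ≤ ENNReal.ofReal (B * r N ^ 2)) :
    IsBigOp P W r := by
  intro ε hε
  refine ⟨√(B / ε) + 1, by positivity, ?_⟩
  filter_upwards [hW, h] with N hWN hN
  refine (measure_rate_lt_le_of_lintegral_sq hWN (by positivity) (hr N) hN).trans
    (ENNReal.ofReal_le_ofReal ?_)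
  rw [div_le_iff₀ (by positivity)]
  have h1 : B / ε ≤ (√(B / ε) + 1) ^ 2 := by
    nlinarith [Real.sq_sqrt (show 0 ≤ B / ε by positivity), Real.sqrt_nonneg (B / ε)]
  calc B = ε * (B / ε) := by field_simp
    _ ≤ _ := by gcongr

theorem of_le_mul (h : IsBigOp P W r) {s : ℕ → ℝ} {C : ℝ} (hC : 0 < C)
    (hs : ∀ᶠ N in atTop, 0 ≤ s N)
    (hle : ∀ᶠ N in atTop, ∀ ω, W' N ω ≤ ENNReal.ofReal (s N) * W N ω)
    (hr : ∀ᶠ N in atTop, s N * r N ≤ C * r' N) : IsBigOp P W' r' := by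
  intro ε hε
  obtain ⟨M, hM, hev⟩ := h ε hε
  refine ⟨M * C, by positivity, ?_⟩
  filter_upwards [hev, hs, hle, hr] with N hN hsN hleN hrN
  refine (measure_mono fun ω hω => ?_).trans hN
  by_contra hlt
  simp only [Set.mem_ofPred_eq, not_lt] at hlt hω
  refine absurd hω (not_lt.2 ?_)
  calc W' N ω ≤ ENNReal.ofReal (s N) * ENNReal.ofReal (M * r N) := by
        grw [hleN ω, hlt]
    _ = ENNReal.ofReal (M * (s N * r N)) := by
        rw [← ENNReal.ofReal_mul hsN]; congr 1; ring
    _ ≤ ENNReal.ofReal (M * C * r' N) := by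
        rw [mul_assoc]; gcongr

theorem mono (h : IsBigOp P W r) (hle : ∀ᶠ N in atTop, ∀ ω, W' N ω ≤ W N ω)
    {C : ℝ} (hC : 0 < C) (hr : ∀ᶠ N in atTop, r N ≤ C * r' N) : IsBigOp P W' r' :=
  h.of_le_mul (s := fun _ => 1) hC (by simp) (by simpa using hle) (by simpa using hr)

theorem add (h : IsBigOp P W r) (h' : IsBigOp P W' r') (hr : ∀ N, 0 ≤ r N) (hr' : ∀ N, 0 ≤ r' N) :
    IsBigOp P (fun N ω => W N ω + W' N ω) (fun N => r N + r' N) := by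
  intro ε hε
  obtain ⟨M, hM, hev⟩ := h (ε / 2) (by positivity)
  obtain ⟨M', hM', hev'⟩ := h' (ε / 2) (by positivity)
  refine ⟨M + M', by positivity, ?_⟩
  filter_upwards [hev, hev'] with N hN hN'
  calc P N {ω | ENNReal.ofReal ((M + M') * (r N + r' N)) < W N ω + W' N ω}
      ≤ P N ({ω | ENNReal.ofReal (M * r N) < W N ω} ∪
          {ω | ENNReal.ofReal (M' * r' N) < W' N ω}) := by
        refine measure_mono fun ω hω => ?_
        by_contra hcon
        simp only [Set.mem_union, Set.mem_ofPred_eq, not_or, not_lt] at hcon hω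
        refine absurd hω (not_lt.2 ((add_le_add hcon.1 hcon.2).trans ?_))
        have h1 := hr N
        have h2 := hr' N
        rw [← ENNReal.ofReal_add (by positivity) (by positivity)]
        refine ENNReal.ofReal_le_ofReal ?_
        nlinarith [mul_nonneg hM.le h2, mul_nonneg hM'.le h1]
    _ ≤ ENNReal.ofReal (ε / 2) + ENNReal.ofReal (ε / 2) :=
        (measure_union_le _ _).trans (add_le_add hN hN')
    _ = ENNReal.ofReal ε := by
        rw [← ENNReal.ofReal_add (by positivity) (by positivity), add_halves]

theorem finset_sum {ι : Type*} (s : Finset ι) {W : ι → ∀ N, Ω N → ℝ≥0∞} (hr : ∀ N, 0 ≤ r N)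
    (h : ∀ k ∈ s, IsBigOp P (W k) r) : IsBigOp P (fun N ω => ∑ k ∈ s, W k N ω) r := by
  classical
  induction s using Finset.induction_on with
  | empty => exact fun ε hε => ⟨1, one_pos, by simp⟩
  | insert k s hk ih =>
    have := (h k (Finset.mem_insert_self k s)).add
      (ih fun j hj => h j (Finset.mem_insert_of_mem hj)) hr hr
    refine this.mono (.of_forall fun N ω => ?_) (C := 2) two_pos (.of_forall fun N => ?_)
    · rw [Finset.sum_insert hk]
    · rw [two_mul]

theorem tendsto_measure_zero (h : IsBigOp P W r) (hr : Tendsto r atTop (𝓝 0)) {δ : ℝ} (hδ : 0 < δ) :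
    Tendsto (fun N => P N {ω | ENNReal.ofReal δ < W N ω}) atTop (𝓝 0) := by
  rw [ENNReal.tendsto_nhds_zero]
  intro ε hε
  obtain ⟨η, hη, hηε⟩ : ∃ η : ℝ, 0 < η ∧ ENNReal.ofReal η ≤ ε := by
    rcases eq_or_ne ε ⊤ with rfl | hne
    · exact ⟨1, one_pos, le_top⟩
    · exact ⟨ε.toReal, ENNReal.toReal_pos hε.ne' hne, (ENNReal.ofReal_toReal hne).le⟩
  obtain ⟨M, hM, hev⟩ := h η hη
  have hMr : Tendsto (fun N => M * r N) atTop (𝓝 0) := by simpa using hr.const_mul M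
  filter_upwards [hev, hMr.eventually_lt_const hδ] with N hN hlt
  refine (measure_mono fun ω hω => ?_).trans (hN.trans hηε)
  exact (ENNReal.ofReal_le_ofReal hlt.le).trans_lt hω

end IsBigOp

/-! ### A Lindeberg central limit theorem for rows of i.i.d. variables -/

/-- A Taylor bound that is small for `|x| ≤ δ` and quadratic elsewhere. -/
theorem norm_exp_sub_taylor_two_le {δ : ℝ} (hδ : 0 < δ) (hδ1 : δ ≤ 1) (x : ℝ) :
    ‖Complex.exp (x * Complex.I) - (1 + x * Complex.I - (x : ℂ) ^ 2 / 2)‖ ≤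
      δ * x ^ 2 + 4 * {y : ℝ | δ < |y|}.indicator (fun y => y ^ 2) x := by
  have hnorm : ‖(x : ℂ) * Complex.I‖ = |x| := by simp
  have hind : 0 ≤ {y : ℝ | δ < |y|}.indicator (fun y => y ^ 2) x :=
    Set.indicator_nonneg (fun y _ => sq_nonneg y) x
  by_cases h1 : |x| ≤ 1
  · have hb := Complex.exp_bound (x := x * Complex.I) (by rw [hnorm]; exact h1) (n := 3)
      (by norm_num)
    have hsum : ∑ m ∈ Finset.range 3, ((x : ℂ) * Complex.I) ^ m / (m.factorial : ℂ) =
        1 + x * Complex.I - (x : ℂ) ^ 2 / 2 := by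
      simp only [Finset.sum_range_succ, Finset.sum_range_zero, Nat.factorial]
      rw [mul_pow _ _ 2, Complex.I_sq]
      push_cast
      ring
    rw [hsum, hnorm] at hb
    have h3 : ‖Complex.exp (x * Complex.I) - (1 + x * Complex.I - (x : ℂ) ^ 2 / 2)‖ ≤
        |x| * x ^ 2 := by
      refine hb.trans ?_
      have hcube : |x| * x ^ 2 = |x| ^ 3 := by rw [← sq_abs x]; ring
      rw [hcube]
      refine mul_le_of_le_one_right (by positivity) ?_
      norm_num [Nat.factorial]
    by_cases h2 : δ < |x|
    · rw [Set.indicator_of_mem (by exact h2)]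
      nlinarith [sq_nonneg x, mul_nonneg hδ.le (sq_nonneg x)]
    · nlinarith [sq_nonneg x]
  · push Not at h1
    have h2 : δ < |x| := hδ1.trans_lt h1
    rw [Set.indicator_of_mem (by exact h2)]
    have hx2 : |x| ^ 2 = x ^ 2 := sq_abs x
    calc ‖Complex.exp (x * Complex.I) - (1 + x * Complex.I - (x : ℂ) ^ 2 / 2)‖
        ≤ ‖Complex.exp (x * Complex.I)‖ + (‖(1 : ℂ)‖ + ‖(x : ℂ) * Complex.I‖ + ‖(x : ℂ) ^ 2 / 2‖) :=
          (norm_sub_le _ _).trans (by gcongr; exact (norm_sub_le _ _).trans (by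
            gcongr; exact norm_add_le _ _))
      _ = 1 + (1 + |x| + x ^ 2 / 2) := by
          rw [Complex.norm_exp_ofReal_mul_I, hnorm]
          simp
      _ ≤ _ := by nlinarith [mul_nonneg hδ.le (sq_nonneg x)]

/-- Second-order expansion of the characteristic function of a centred law at `s`, with an error
that is controlled by the truncated second moment of Lindeberg's condition. -/
theorem norm_charFun_map_sub_le {D : Type*} [MeasurableSpace D] {Q : Measure D}
    [IsProbabilityMeasure Q] {f : D → ℝ} (hf : Measurable f) (hf2 : MemLp f 2 Q)
    (hf0 : ∫ z, f z ∂Q = 0) {δ : ℝ} (hδ : 0 < δ) (hδ1 : δ ≤ 1) (s : ℝ) :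
    ‖charFun (Q.map f) s - (1 - ((s ^ 2 * ∫ z, f z ^ 2 ∂Q : ℝ) : ℂ) / 2)‖ ≤
      s ^ 2 * (δ * ∫ z, f z ^ 2 ∂Q + 4 * ∫ z in {z | δ < |s * f z|}, f z ^ 2 ∂Q) := by
  have hint : Integrable f Q := hf2.integrable (by norm_num)
  have hint2 : Integrable (fun z => f z ^ 2) Q := hf2.integrable_sq
  have hset : MeasurableSet {z | δ < |s * f z|} :=
    measurableSet_lt measurable_const (by fun_prop)
  have hexp : Integrable (fun z => Complex.exp ((s * f z : ℝ) * Complex.I)) Q := by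
    refine Integrable.of_bound (by fun_prop) 1 (ae_of_all _ fun z => ?_)
    rw [Complex.norm_exp_ofReal_mul_I]
  have hlin : Integrable (fun z => ((s * f z : ℝ) : ℂ) * Complex.I) Q :=
    ((hint.const_mul s).ofReal (𝕜 := ℂ)).mul_const _
  have hquad : Integrable (fun z => ((s * f z : ℝ) : ℂ) ^ 2 / 2) Q := by
    have := ((hint2.const_mul (s ^ 2)).ofReal (𝕜 := ℂ)).div_const 2
    refine this.congr (ae_of_all _ fun z => ?_)
    simp only [RCLike.ofReal_mul, RCLike.ofReal_pow, Complex.coe_algebraMap]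
    push_cast
    simp [mul_pow]
  have hone : Integrable (fun _ : D => (1 : ℂ)) Q := integrable_const _
  have hval : charFun (Q.map f) s - (1 - ((s ^ 2 * ∫ z, f z ^ 2 ∂Q : ℝ) : ℂ) / 2) =
      ∫ z, (Complex.exp ((s * f z : ℝ) * Complex.I) -
        (1 + ((s * f z : ℝ) : ℂ) * Complex.I - ((s * f z : ℝ) : ℂ) ^ 2 / 2)) ∂Q := by
    have hadd : Integrable (fun z => 1 + ((s * f z : ℝ) : ℂ) * Complex.I) Q := hone.add hlin
    have htaylor : Integrable (fun z => 1 + ((s * f z : ℝ) : ℂ) * Complex.I -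
        ((s * f z : ℝ) : ℂ) ^ 2 / 2) Q := hadd.sub hquad
    rw [integral_sub hexp htaylor, integral_sub hadd hquad,
      integral_add hone hlin, charFun_apply_real, integral_map hf.aemeasurable (by fun_prop)]
    have e1 : ∫ z, ((s * f z : ℝ) : ℂ) * Complex.I ∂Q = 0 := by
      rw [integral_mul_const, integral_complex_ofReal, integral_const_mul, hf0]; simp
    have e2 : ∫ z, ((s * f z : ℝ) : ℂ) ^ 2 / 2 ∂Q = ((s ^ 2 * ∫ z, f z ^ 2 ∂Q : ℝ) : ℂ) / 2 := by
      rw [integral_div, ← integral_const_mul, ← integral_complex_ofReal]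
      congr 2 with z
      push_cast
      ring
    rw [e1, e2]
    simp
  rw [hval]
  refine (norm_integral_le_of_norm_le (g := fun z => s ^ 2 * (δ * f z ^ 2 +
    4 * {z | δ < |s * f z|}.indicator (fun z => f z ^ 2) z)) ?_ (ae_of_all _ fun z => ?_)).trans
    (le_of_eq ?_)
  · exact ((hint2.const_mul δ).add ((hint2.indicator hset).const_mul 4)).const_mul _
  · refine (norm_exp_sub_taylor_two_le hδ hδ1 (s * f z)).trans (le_of_eq ?_)
    by_cases h : δ < |s * f z|
    · rw [Set.indicator_of_mem (by exact h), Set.indicator_of_mem (by exact h)]; ring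
    · rw [Set.indicator_of_notMem (by exact h), Set.indicator_of_notMem (by exact h)]; ring
  · rw [integral_const_mul, integral_add (hint2.const_mul δ) ((hint2.indicator hset).const_mul 4),
      integral_const_mul, integral_const_mul, integral_indicator hset]

/-- If `T N - S N` tends to zero in probability, the characteristic functions of `T N` and `S N`
have the same limit. The variables may live on spaces that depend on `N`. -/
theorem tendsto_charFun_of_tendsto_measure_sub {Ω : ℕ → Type*} [∀ N, MeasurableSpace (Ω N)]
    {P : ∀ N, Measure (Ω N)} [∀ N, IsProbabilityMeasure (P N)] {S T : ∀ N, Ω N → ℝ}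
    (hS : ∀ N, AEMeasurable (S N) (P N)) (hT : ∀ N, AEMeasurable (T N) (P N))
    (hsub : ∀ δ : ℝ, 0 < δ → Tendsto (fun N => P N {ω | δ < |T N ω - S N ω|}) atTop (𝓝 0))
    {t : ℝ} {l : ℂ} (h : Tendsto (fun N => charFun ((P N).map (S N)) t) atTop (𝓝 l)) :
    Tendsto (fun N => charFun ((P N).map (T N)) t) atTop (𝓝 l) := by
  suffices hd : Tendsto (fun N => charFun ((P N).map (T N)) t - charFun ((P N).map (S N)) t)
      atTop (𝓝 0) by simpa using hd.add h
  have hint : ∀ N (U : Ω N → ℝ), AEMeasurable U (P N) →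
      Integrable (fun ω => Complex.exp (t * U ω * Complex.I)) (P N) := fun N U hU => by
    refine Integrable.of_bound (by fun_prop) 1 (ae_of_all _ fun z => ?_)
    rw [← Complex.ofReal_mul, Complex.norm_exp_ofReal_mul_I]
  have hbound : ∀ N, ∀ δ : ℝ, 0 < δ →
      ‖charFun ((P N).map (T N)) t - charFun ((P N).map (S N)) t‖ ≤
        |t| * δ + 2 * (P N).real {ω | δ < |T N ω - S N ω|} := by
    intro N δ hδ
    have hset : NullMeasurableSet {ω | δ < |T N ω - S N ω|} (P N) :=
      nullMeasurableSet_lt aemeasurable_const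
        (measurable_norm.comp_aemeasurable ((hT N).sub (hS N)))
    rw [charFun_apply_real, charFun_apply_real, integral_map (hT N) (by fun_prop),
      integral_map (hS N) (by fun_prop), ← integral_sub (hint N _ (hT N)) (hint N _ (hS N))]
    refine (norm_integral_le_of_norm_le (g := fun ω => |t| * δ +
      {ω | δ < |T N ω - S N ω|}.indicator (fun _ => (2 : ℝ)) ω) ?_ (ae_of_all _ fun ω => ?_)).trans
      (le_of_eq ?_)
    · exact (integrable_const _).add ((integrable_const _).indicator₀ hset)
    · have hfac : Complex.exp (t * T N ω * Complex.I) - Complex.exp (t * S N ω * Complex.I) =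
          Complex.exp ((t * S N ω : ℝ) * Complex.I) *
            (Complex.exp (Complex.I * (t * (T N ω - S N ω) : ℝ)) - 1) := by
        rw [mul_sub, ← Complex.exp_add, mul_one]
        congr 2 <;> push_cast <;> ring
      rw [hfac, norm_mul, Complex.norm_exp_ofReal_mul_I, one_mul]
      by_cases hω : δ < |T N ω - S N ω|
      · rw [Set.indicator_of_mem (by exact hω)]
        have h2 : ‖Complex.exp (Complex.I * (t * (T N ω - S N ω) : ℝ)) - 1‖ ≤ 1 + 1 := by
          refine (norm_sub_le _ _).trans ?_
          rw [Complex.norm_exp_I_mul_ofReal, norm_one]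
        have : 0 ≤ |t| * δ := by positivity
        linarith
      · rw [Set.indicator_of_notMem (by exact hω), add_zero]
        refine Real.norm_exp_I_mul_ofReal_sub_one_le.trans ?_
        rw [Real.norm_eq_abs, abs_mul]
        gcongr
        exact not_lt.1 hω
    · rw [integral_add (integrable_const _) ((integrable_const _).indicator₀ hset),
        integral_indicator₀ hset]
      simp [mul_comm]
  rw [Metric.tendsto_nhds]
  intro ε hε
  have hδ : 0 < ε / (2 * (|t| + 1)) := by positivity
  have hreal := (ENNReal.tendsto_toReal ENNReal.zero_ne_top).comp (hsub _ hδ)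
  have h2 : Tendsto (fun N => 2 * (P N).real {ω | ε / (2 * (|t| + 1)) < |T N ω - S N ω|})
      atTop (𝓝 0) := by
    simpa [Function.comp_def, Measure.real] using hreal.const_mul 2
  filter_upwards [h2.eventually_lt_const (half_pos hε)] with N hN
  rw [dist_zero_right]
  refine (hbound N _ hδ).trans_lt ?_
  have : |t| * (ε / (2 * (|t| + 1))) ≤ ε / 2 := by
    have : |t| * (ε / (2 * (|t| + 1))) = (ε / 2) * (|t| / (|t| + 1)) := by field_simp
    rw [this]
    refine mul_le_of_le_one_right (by positivity) ?_
    rw [div_le_one (by positivity)]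
    linarith
  linarith

/-- **Lindeberg's theorem** for triangular arrays whose rows are i.i.d.: `f N (Z N i)`, `i < N`, are
centred, `w N` is asymptotically equivalent to their variance, and `T N` differs from the normalised
row sum by a term that tends to zero in probability. -/
theorem tendstoInDistribution_of_lindeberg {D : ℕ → Type*} [∀ N, MeasurableSpace (D N)]
    {Q : ∀ N, Measure (D N)} [∀ N, IsProbabilityMeasure (Q N)]
    {Ω : ℕ → Type*} [∀ N, MeasurableSpace (Ω N)] {P : ∀ N, Measure (Ω N)}
    [∀ N, IsProbabilityMeasure (P N)] {Z : ∀ N, Fin N → Ω N → D N}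
    (hZ : ∀ N i, Measurable (Z N i)) (hlaw : ∀ N i, (P N).map (Z N i) = Q N)
    (hindep : ∀ N, iIndepFun (Z N) (P N)) {f : ∀ N, D N → ℝ} (hf : ∀ N, Measurable (f N))
    (hf2 : ∀ᶠ N in atTop, MemLp (f N) 2 (Q N)) (hf0 : ∀ᶠ N in atTop, ∫ z, f N z ∂(Q N) = 0)
    {w : ℕ → ℝ} (hw : ∀ᶠ N in atTop, 0 < w N)
    (hvar : Tendsto (fun N => (∫ z, f N z ^ 2 ∂(Q N)) / w N) atTop (𝓝 1))
    (hlind : ∀ δ : ℝ, 0 < δ → Tendsto (fun N : ℕ => (w N)⁻¹ *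
      ∫ z in {z | δ * √(N * w N) < |f N z|}, f N z ^ 2 ∂(Q N)) atTop (𝓝 0))
    {T : ∀ N, Ω N → ℝ} (hT : ∀ N, AEMeasurable (T N) (P N))
    (hrem : ∀ δ : ℝ, 0 < δ → Tendsto (fun N : ℕ => P N
      {ω | δ < |T N ω - (√(N * w N))⁻¹ * ∑ i, f N (Z N i ω)|}) atTop (𝓝 0)) :
    TendstoInDistribution T atTop (id : ℝ → ℝ) P (gaussianReal 0 1) where
  forall_aemeasurable := hT
  tendsto := by
    refine ProbabilityMeasure.tendsto_iff_tendsto_charFun.2 fun t => ?_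
    simp only [ProbabilityMeasure.coe_mk, Measure.map_id]
    have hfZ : ∀ N i, AEMeasurable (fun ω => f N (Z N i ω)) (P N) :=
      fun N i => ((hf N).comp (hZ N i)).aemeasurable
    have hsum : ∀ N, AEMeasurable (fun ω => ∑ i, f N (Z N i ω)) (P N) :=
      fun N => Finset.aemeasurable_fun_sum _ fun i _ => hfZ N i
    refine tendsto_charFun_of_tendsto_measure_sub (fun N => (hsum N).const_mul _) hT hrem ?_
    have hchar : ∀ N : ℕ, charFun ((P N).map fun ω => (√(N * w N))⁻¹ * ∑ i, f N (Z N i ω)) t =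
        (1 + (charFun ((Q N).map (f N)) ((√(N * w N))⁻¹ * t) - 1)) ^ N := by
      intro N
      rw [charFun_map_mul_comp (hsum N), iIndepFun.charFun_map_fun_sum_eq_prod
        (X := fun i ω => f N (Z N i ω)) (hfZ N) ((hindep N).comp (fun _ => f N) fun _ => hf N)]
      have : ∀ i, (P N).map (fun ω => f N (Z N i ω)) = (Q N).map (f N) := fun i => by
        rw [← hlaw N i, Measure.map_map (hf N) (hZ N i)]; rfl
      simp [this]
    simp_rw [hchar]
    rw [charFun_gaussianReal]
    refine Complex.tendsto_one_add_pow_exp_of_tendsto ?_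
    -- the main term converges by `hvar`, the Taylor error by Lindeberg's condition
    have hmain : Tendsto (fun N : ℕ => (((-(t ^ 2 / 2) *
        ((∫ z, f N z ^ 2 ∂(Q N)) / w N) : ℝ)) : ℂ)) atTop (𝓝 (-(t ^ 2 / 2) : ℝ)) := by
      refine (Complex.continuous_ofReal.tendsto _).comp ?_
      simpa using hvar.const_mul (-(t ^ 2 / 2))
    have herr : Tendsto (fun N : ℕ => (N : ℂ) * (charFun ((Q N).map (f N)) ((√(N * w N))⁻¹ * t) -
        (1 - ((((√(N * w N))⁻¹ * t) ^ 2 * ∫ z, f N z ^ 2 ∂(Q N) : ℝ) : ℂ) / 2))) atTop (𝓝 0) := by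
      rw [tendsto_zero_iff_norm_tendsto_zero]
      have hbd : ∀ δ : ℝ, 0 < δ → δ ≤ 1 → ∀ᶠ N : ℕ in atTop,
          ‖(N : ℂ) * (charFun ((Q N).map (f N)) ((√(N * w N))⁻¹ * t) -
            (1 - ((((√(N * w N))⁻¹ * t) ^ 2 * ∫ z, f N z ^ 2 ∂(Q N) : ℝ) : ℂ) / 2))‖ ≤
          t ^ 2 * (δ * ((∫ z, f N z ^ 2 ∂(Q N)) / w N) + 4 * ((w N)⁻¹ *
            ∫ z in {z | δ / (|t| + 1) * √(N * w N) < |f N z|}, f N z ^ 2 ∂(Q N))) := by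
        intro δ hδ hδ1
        filter_upwards [hf2, hf0, hw, eventually_gt_atTop 0] with N h2 h0 hwN hN
        have hNpos : (0 : ℝ) < N := by exact_mod_cast hN
        have hNw : 0 < √(N * w N) := by positivity
        have hsq : N * ((√(N * w N))⁻¹ * t) ^ 2 = t ^ 2 * (w N)⁻¹ := by
          rw [mul_pow, inv_pow, Real.sq_sqrt (by positivity)]
          field_simp
        rw [norm_mul, Complex.norm_natCast]
        have hsub : ∫ z in {z | δ < |(√(N * w N))⁻¹ * t * f N z|}, f N z ^ 2 ∂(Q N) ≤
            ∫ z in {z | δ / (|t| + 1) * √(N * w N) < |f N z|}, f N z ^ 2 ∂(Q N) := by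
          refine setIntegral_mono_set h2.integrable_sq.integrableOn
            (ae_of_all _ fun z => sq_nonneg _) (Eventually.of_forall fun z hz => ?_)
          change δ < |(√(N * w N))⁻¹ * t * f N z| at hz
          change δ / (|t| + 1) * √(N * w N) < |f N z|
          rw [abs_mul, abs_mul, abs_of_pos (inv_pos.2 hNw)] at hz
          rw [div_mul_eq_mul_div, div_lt_iff₀ (by positivity)]
          calc δ * √(N * w N) < (√(N * w N))⁻¹ * |t| * |f N z| * √(N * w N) := by gcongr
            _ = |f N z| * |t| := by field_simp
            _ ≤ _ := by gcongr; linarith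
        calc (N : ℝ) * ‖charFun ((Q N).map (f N)) ((√(N * w N))⁻¹ * t) -
            (1 - ((((√(N * w N))⁻¹ * t) ^ 2 * ∫ z, f N z ^ 2 ∂(Q N) : ℝ) : ℂ) / 2)‖
            ≤ N * (((√(N * w N))⁻¹ * t) ^ 2 * (δ * ∫ z, f N z ^ 2 ∂(Q N) +
              4 * ∫ z in {z | δ < |(√(N * w N))⁻¹ * t * f N z|}, f N z ^ 2 ∂(Q N))) := by
              gcongr
              exact norm_charFun_map_sub_le (hf N) h2 h0 hδ hδ1 _
          _ ≤ N * (((√(N * w N))⁻¹ * t) ^ 2 * (δ * ∫ z, f N z ^ 2 ∂(Q N) +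
              4 * ∫ z in {z | δ / (|t| + 1) * √(N * w N) < |f N z|}, f N z ^ 2 ∂(Q N))) := by
              gcongr
          _ = _ := by
              rw [← mul_assoc, hsq]
              field_simp
      rw [Metric.tendsto_nhds]
      intro ε hε
      set δ : ℝ := min 1 (ε / (2 * (t ^ 2 + 1))) with hδdef
      have hδ : 0 < δ := lt_min one_pos (by positivity)
      have hlim : Tendsto (fun N : ℕ => t ^ 2 * (δ * ((∫ z, f N z ^ 2 ∂(Q N)) / w N) +
          4 * ((w N)⁻¹ * ∫ z in {z | δ / (|t| + 1) * √(N * w N) < |f N z|}, f N z ^ 2 ∂(Q N))))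
          atTop (𝓝 (t ^ 2 * (δ * 1 + 4 * 0))) :=
        ((hvar.const_mul δ).add ((hlind _ (by positivity)).const_mul 4)).const_mul (t ^ 2)
      have hlt : t ^ 2 * (δ * 1 + 4 * 0) < ε := by
        have h1 : δ ≤ ε / (2 * (t ^ 2 + 1)) := min_le_right _ _
        rw [le_div_iff₀ (by positivity)] at h1
        nlinarith [sq_nonneg t]
      filter_upwards [hbd δ hδ (min_le_left _ _), hlim.eventually_lt_const hlt] with N h1 h2
      rw [dist_zero_right, norm_norm]
      exact h1.trans_lt h2
    have hgoal := herr.add hmain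
    have e0 : Complex.exp (t * (0 : ℝ) * Complex.I - ((1 : NNReal) : ℝ) * t ^ 2 / 2) =
        Complex.exp (0 + (-(t ^ 2 / 2) : ℝ)) := by
      congr 1
      push_cast
      ring
    have hlimit : ((0 : ℂ) + (-(t ^ 2 / 2) : ℝ)) =
        (t * (0 : ℝ) * Complex.I - ((1 : NNReal) : ℝ) * t ^ 2 / 2) := by
      push_cast
      ring
    rw [hlimit] at hgoal
    refine hgoal.congr' ?_
    filter_upwards [hw, eventually_gt_atTop 0] with N hwN hN
    have hNpos : (0 : ℝ) < N := by exact_mod_cast hN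
    have hsq : ((√(N * w N))⁻¹ * t) ^ 2 = t ^ 2 / (N * w N) := by
      rw [mul_pow, inv_pow, Real.sq_sqrt (by positivity)]
      field_simp
    rw [hsq]
    have hN' : (N : ℂ) ≠ 0 := by exact_mod_cast hN.ne'
    have hw' : (w N : ℂ) ≠ 0 := by exact_mod_cast hwN.ne'
    push_cast
    field_simp
    ring

/-! ### Cross-fitting -/

theorem lintegral_sq_sum_pi {ι D : Type*} [Fintype ι] [MeasurableSpace D] {Q : Measure D}
    [IsProbabilityMeasure Q] {g : D → ℝ} (hg : MemLp g 2 Q) (h0 : ∫ z, g z ∂Q = 0) :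
    ∫⁻ y, ‖∑ i, g (y i)‖ₑ ^ 2 ∂(Measure.pi fun _ : ι => Q) =
      Fintype.card ι * ∫⁻ z, ‖g z‖ₑ ^ 2 ∂Q := by
  have hmem : ∀ i : ι, MemLp (fun y : ι → D => g (y i)) 2 (Measure.pi fun _ : ι => Q) :=
    fun i => hg.comp_measurePreserving (measurePreserving_eval (fun _ : ι => Q) i)
  have hS : MemLp (∑ i, fun y : ι → D => g (y i)) 2 (Measure.pi fun _ : ι => Q) :=
    memLp_finsetSum' _ fun i _ => hmem i
  have hmean : ∫ y, (∑ i, fun y : ι → D => g (y i)) y ∂(Measure.pi fun _ : ι => Q) = 0 := by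
    simp only [Finset.sum_apply]
    rw [integral_finsetSum _ fun i _ => (hmem i).integrable (by norm_num)]
    refine Finset.sum_eq_zero fun i _ => ?_
    rw [integral_comp_eval (μ := fun _ : ι => Q) (i := i) hg.aestronglyMeasurable, h0]
  have e1 := ofReal_variance hS
  have e2 := ofReal_variance hg
  rw [evariance, hmean] at e1
  rw [evariance, h0] at e2
  simp only [sub_zero, Finset.sum_apply] at e1 e2
  rw [← e1, variance_sum_pi fun _ => hg, ← e2]
  simp [ENNReal.ofReal_mul]

/-- Fubini's theorem over the training data `J` and the held-out data `Jᶜ` of a fixed partition. -/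
theorem lintegral_sq_sum_compl_le {ι D : Type*} [Fintype ι] [DecidableEq ι] [MeasurableSpace D]
    {Q : Measure D} [IsProbabilityMeasure Q] (J : Finset ι) {h : (J → D) → D → ℝ}
    (hh : Measurable (Function.uncurry h)) (h2 : ∀ s, MemLp (h s) 2 Q)
    (h0 : ∀ s, ∫ z, h s z ∂Q = 0) {B : ℝ≥0∞} (hB : ∀ s, ∫⁻ z, ‖h s z‖ₑ ^ 2 ∂Q ≤ B) :
    ∫⁻ z, ‖∑ i ∈ Jᶜ, h (fun j => z j) (z i)‖ₑ ^ 2 ∂(Measure.pi fun _ : ι => Q) ≤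
      Fintype.card ι * B := by
  let F : ({i // i ∈ J} → D) × ({i // ¬ i ∈ J} → D) → ℝ≥0∞ :=
    fun x => ‖∑ i, h x.1 (x.2 i)‖ₑ ^ 2
  have hF : Measurable F := by
    refine Measurable.pow_const (Measurable.enorm (Finset.measurable_sum _ fun i _ => ?_)) 2
    exact hh.comp (measurable_fst.prodMk ((measurable_pi_apply i).comp measurable_snd))
  have hmp := measurePreserving_piEquivPiSubtypeProd (fun _ : ι => Q) (fun i => i ∈ J)
  have heq : ∀ z : ι → D, ‖∑ i ∈ Jᶜ, h (fun j => z j) (z i)‖ₑ ^ 2 =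
      F (MeasurableEquiv.piEquivPiSubtypeProd (fun _ : ι => D) (fun i => i ∈ J) z) := by
    intro z
    simp only [F]
    congr 2
    exact Finset.sum_subtype (p := fun i => ¬ i ∈ J) Jᶜ (fun i => Finset.mem_compl)
      (fun i => h (fun j => z j) (z i))
  simp_rw [heq]
  rw [hmp.lintegral_comp hF, lintegral_prod _ hF.aemeasurable]
  refine (lintegral_mono (g := fun _ => Fintype.card ι * B) fun s => ?_).trans (by simp)
  simp only [F]
  rw [lintegral_sq_sum_pi (h2 s) (h0 s)]
  gcongr
  · exact Fintype.card_subtype_le _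
  · exact hB s

/-- The second moment of a centred i.i.d. sum. -/
theorem lintegral_sq_sum_iid {ι D Ω : Type*} [Fintype ι] [MeasurableSpace D] [MeasurableSpace Ω]
    {P : Measure Ω} [IsProbabilityMeasure P] {Q : Measure D} [IsProbabilityMeasure Q]
    {Z : ι → Ω → D} (hZ : ∀ i, Measurable (Z i)) (hlaw : ∀ i, P.map (Z i) = Q)
    (hindep : iIndepFun Z P) {g : D → ℝ} (hgm : Measurable g) (hg : MemLp g 2 Q)
    (h0 : ∫ z, g z ∂Q = 0) :
    ∫⁻ ω, ‖∑ i, g (Z i ω)‖ₑ ^ 2 ∂P = Fintype.card ι * ∫⁻ z, ‖g z‖ₑ ^ 2 ∂Q := by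
  have hpi : P.map (fun ω i => Z i ω) = Measure.pi fun _ : ι => Q := by
    rw [(iIndepFun_iff_map_fun_eq_pi_map fun i => (hZ i).aemeasurable).1 hindep]
    simp_rw [hlaw]
  have hF : Measurable fun y : ι → D => ‖∑ i, g (y i)‖ₑ ^ 2 :=
    (Finset.measurable_sum _ fun i _ => hgm.comp (measurable_pi_apply i)).enorm.pow_const 2
  rw [← lintegral_sq_sum_pi hg h0, ← hpi, lintegral_map hF (measurable_pi_lambda _ hZ)]

theorem measurable_sum_compl {ι D Φ : Type*} [Fintype ι] [DecidableEq ι]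
    [MeasurableSpace D] [MeasurableSpace Φ] [Countable Φ] [MeasurableSingletonClass Φ]
    (J : Φ → Finset ι) {h : ∀ J : Finset ι, (J → D) → D → ℝ}
    (hh : ∀ J, Measurable (Function.uncurry (h J))) :
    Measurable fun x : Φ × (ι → D) => ∑ i ∈ (J x.1)ᶜ, h (J x.1) (fun j => x.2 j) (x.2 i) := by
  refine measurable_from_prod_countable_right fun f => ?_
  change Measurable fun z : ι → D => ∑ i ∈ (J f)ᶜ, h (J f) (fun j => z j) (z i)
  refine Finset.measurable_sum _ fun i _ => ?_
  have hdata : Measurable fun z : ι → D => ((fun j : J f => z j), z i) :=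
    (measurable_pi_lambda _ fun j => measurable_pi_apply _).prodMk (measurable_pi_apply i)
  exact (hh (J f)).comp hdata

/-- The second moment of a sum over the observations outside a random training set `J φ`, where `φ`
is independent of the sample and the summands depend on the training data. Conditionally on `φ` and
on the training data the summands are independent and centred, so that no cross terms appear. -/
theorem lintegral_sq_sum_crossfit_le {ι D Φ Ω : Type*} [Fintype ι] [DecidableEq ι]
    [MeasurableSpace D] [MeasurableSpace Φ] [Countable Φ] [MeasurableSingletonClass Φ]
    [MeasurableSpace Ω] {P : Measure Ω} [IsProbabilityMeasure P]
    {Q : Measure D} [IsProbabilityMeasure Q] {Z : ι → Ω → D} (hZ : ∀ i, Measurable (Z i))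
    (hlaw : ∀ i, P.map (Z i) = Q) (hindep : iIndepFun Z P)
    {φ : Ω → Φ} (hφ : Measurable φ) (hφZ : IndepFun φ (fun ω i => Z i ω) P)
    (J : Φ → Finset ι) {h : ∀ J : Finset ι, (J → D) → D → ℝ}
    (hh : ∀ J, Measurable (Function.uncurry (h J))) (h2 : ∀ J s, MemLp (h J s) 2 Q)
    (h0 : ∀ J s, ∫ z, h J s z ∂Q = 0) {B : ℝ≥0∞} (hB : ∀ J s, ∫⁻ z, ‖h J s z‖ₑ ^ 2 ∂Q ≤ B) :
    ∫⁻ ω, ‖∑ i ∈ (J (φ ω))ᶜ, h (J (φ ω)) (fun j => Z j ω) (Z i ω)‖ₑ ^ 2 ∂P ≤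
      Fintype.card ι * B := by
  let G : Φ × (ι → D) → ℝ≥0∞ :=
    fun x => ‖∑ i ∈ (J x.1)ᶜ, h (J x.1) (fun j => x.2 j) (x.2 i)‖ₑ ^ 2
  have hG : Measurable G := (measurable_sum_compl J hh).enorm.pow_const 2
  have hZ' : Measurable fun ω i => Z i ω := measurable_pi_lambda _ hZ
  have hpi : P.map (fun ω i => Z i ω) = Measure.pi fun _ : ι => Q := by
    rw [(iIndepFun_iff_map_fun_eq_pi_map fun i => (hZ i).aemeasurable).1 hindep]
    simp_rw [hlaw]
  have hjoint := (indepFun_iff_map_prod_eq_prod_map_map hφ.aemeasurable hZ'.aemeasurable).1 hφZ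
  have : IsProbabilityMeasure (P.map φ) := Measure.isProbabilityMeasure_map hφ.aemeasurable
  calc _ = ∫⁻ ω, G (φ ω, fun i => Z i ω) ∂P := rfl
    _ = ∫⁻ x, G x ∂((P.map φ).prod (Measure.pi fun _ : ι => Q)) := by
        rw [← lintegral_map (f := G) hG (hφ.prodMk hZ'), hjoint, hpi]
    _ = ∫⁻ f, ∫⁻ z, G (f, z) ∂(Measure.pi fun _ : ι => Q) ∂(P.map φ) :=
        lintegral_prod _ hG.aemeasurable
    _ ≤ ∫⁻ _, Fintype.card ι * B ∂(P.map φ) :=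
        lintegral_mono fun f => lintegral_sq_sum_compl_le (J f) (hh _) (h2 _) (h0 _) (hB _)
    _ = _ := by simp

/-! ### Weighted conditional moment bounds -/

section CondMoments

variable {Ω E : Type*} [MeasurableSpace Ω] [mE : MeasurableSpace E] {Q : Measure Ω}
  {X : Ω → E}

theorem integrable_weight_mul_condExp {G : Ω → ℝ} (hG : Integrable G Q)
    {w : E → ℝ} (hw : Measurable w) (hwG : Integrable (fun ω => w (X ω) * G ω) Q) :
    Integrable (fun ω => w (X ω) * (Q[G | mE.comap X]) ω) Q := by
  have hwm : StronglyMeasurable[mE.comap X] fun ω => w (X ω) :=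
    (hw.comp (comap_measurable X)).stronglyMeasurable
  exact integrable_condExp.congr (condExp_mul_of_stronglyMeasurable_left hwm hwG hG)

variable [IsProbabilityMeasure Q]

/-- A conditional bound on `G` bounds its mean under every weight `w(X)`; `w` may take the value
`∞` and nothing is assumed about the integrability of `w(X) * G`. -/
theorem lintegral_weight_mul_le_of_condExp_le (hX : Measurable X) {G : Ω → ℝ} (hGm : Measurable G)
    (hG : Integrable G Q) (hG0 : ∀ ω, 0 ≤ G ω) {C : ℝ}
    (hC : ∀ᵐ ω ∂Q, (Q[G | mE.comap X]) ω ≤ C) {w : E → ℝ≥0∞} (hw : Measurable w) :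
    ∫⁻ ω, w (X ω) * ENNReal.ofReal (G ω) ∂Q ≤ ENNReal.ofReal C * ∫⁻ ω, w (X ω) ∂Q := by
  have hle : (Q.withDensity fun ω => ENNReal.ofReal (G ω)).map X ≤
      ENNReal.ofReal C • Q.map X := by
    refine Measure.le_iff.2 fun B hB => ?_
    rw [Measure.map_apply hX hB, withDensity_apply _ (hX hB), Measure.smul_apply,
      Measure.map_apply hX hB, smul_eq_mul,
      ← ofReal_integral_eq_lintegral_ofReal hG.integrableOn (ae_of_all _ hG0),
      ← setIntegral_condExp hX.comap_le hG ⟨B, hB, rfl⟩]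
    have h1 : ∫ ω in X ⁻¹' B, (Q[G | mE.comap X]) ω ∂Q ≤ ∫ _ in X ⁻¹' B, C ∂Q :=
      setIntegral_mono_ae integrable_condExp.integrableOn (integrable_const C).integrableOn hC
    rw [setIntegral_const, smul_eq_mul] at h1
    refine (ENNReal.ofReal_le_ofReal h1).trans (le_of_eq ?_)
    rw [ENNReal.ofReal_mul measureReal_nonneg, mul_comm, ofReal_measureReal]
  calc ∫⁻ ω, w (X ω) * ENNReal.ofReal (G ω) ∂Q
      = ∫⁻ e, w e ∂((Q.withDensity fun ω => ENNReal.ofReal (G ω)).map X) := by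
        have hwX : Measurable fun ω => w (X ω) := hw.comp hX
        rw [lintegral_map hw hX, lintegral_withDensity_eq_lintegral_mul _ (by fun_prop) hwX]
        simp [mul_comm]
    _ ≤ ∫⁻ e, w e ∂(ENNReal.ofReal C • Q.map X) := lintegral_mono' hle le_rfl
    _ = _ := by rw [lintegral_smul_measure, lintegral_map hw hX, smul_eq_mul]

theorem integrable_weight_mul_of_condExp_le (hX : Measurable X) {G : Ω → ℝ} (hGm : Measurable G)
    (hG : Integrable G Q) (hG0 : ∀ ω, 0 ≤ G ω) {C : ℝ}
    (hC : ∀ᵐ ω ∂Q, (Q[G | mE.comap X]) ω ≤ C) {w : E → ℝ} (hw : Measurable w)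
    (hwi : Integrable (fun ω => w (X ω)) Q) :
    Integrable (fun ω => w (X ω) * G ω) Q := by
  refine ⟨((hw.comp hX).mul hGm).aestronglyMeasurable, ?_⟩
  rw [hasFiniteIntegral_iff_enorm]
  have hbound := lintegral_weight_mul_le_of_condExp_le hX hGm hG hG0 hC (w := fun e => ‖w e‖ₑ)
    hw.enorm
  refine lt_of_le_of_lt ?_ (hbound.trans_lt (ENNReal.mul_lt_top ENNReal.ofReal_lt_top hwi.2))
  refine lintegral_mono fun ω => ?_
  rw [enorm_mul, Real.enorm_of_nonneg (hG0 ω)]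

theorem integral_weight_mul_eq_condExp (hX : Measurable X) {G : Ω → ℝ} (hG : Integrable G Q)
    {w : E → ℝ} (hw : Measurable w) (hwG : Integrable (fun ω => w (X ω) * G ω) Q) :
    ∫ ω, w (X ω) * G ω ∂Q = ∫ ω, w (X ω) * (Q[G | mE.comap X]) ω ∂Q := by
  have hwm : StronglyMeasurable[mE.comap X] fun ω => w (X ω) :=
    (hw.comp (comap_measurable X)).stronglyMeasurable
  have h := condExp_mul_of_stronglyMeasurable_left hwm hwG hG
  rw [← integral_condExp hX.comap_le]
  exact integral_congr_ae h

theorem integral_weight_mul_le_of_condExp_le (hX : Measurable X) {G : Ω → ℝ}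
    (hG : Integrable G Q) {C : ℝ} (hC : ∀ᵐ ω ∂Q, (Q[G | mE.comap X]) ω ≤ C)
    {w : E → ℝ} (hw : Measurable w) (hw0 : ∀ᵐ ω ∂Q, 0 ≤ w (X ω))
    (hwi : Integrable (fun ω => w (X ω)) Q) (hwG : Integrable (fun ω => w (X ω) * G ω) Q) :
    ∫ ω, w (X ω) * G ω ∂Q ≤ C * ∫ ω, w (X ω) ∂Q := by
  rw [integral_weight_mul_eq_condExp hX hG hw hwG, ← integral_const_mul]
  refine integral_mono_ae (integrable_weight_mul_condExp hG hw hwG) (hwi.const_mul C) ?_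
  filter_upwards [hC, hw0] with ω h1 h2
  nlinarith

theorem le_integral_weight_mul_of_le_condExp (hX : Measurable X) {G : Ω → ℝ}
    (hG : Integrable G Q) {C : ℝ} (hC : ∀ᵐ ω ∂Q, C ≤ (Q[G | mE.comap X]) ω)
    {w : E → ℝ} (hw : Measurable w) (hw0 : ∀ᵐ ω ∂Q, 0 ≤ w (X ω))
    (hwi : Integrable (fun ω => w (X ω)) Q) (hwG : Integrable (fun ω => w (X ω) * G ω) Q) :
    C * ∫ ω, w (X ω) ∂Q ≤ ∫ ω, w (X ω) * G ω ∂Q := by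
  rw [integral_weight_mul_eq_condExp hX hG hw hwG, ← integral_const_mul]
  refine integral_mono_ae (hwi.const_mul C) (integrable_weight_mul_condExp hG hw hwG) ?_
  filter_upwards [hC, hw0] with ω h1 h2
  nlinarith

/-- Among the functions of the covariates the regression function has the smallest conditional mean
squared error, so a lower bound for its error holds for every other function as well. -/
theorem le_condExp_sq_sub_of_le_condExp_sq_sub_condExp (hX : Measurable X) {Y : Ω → ℝ}
    (hY : MemLp Y 2 Q) {g : E → ℝ} (hg : Measurable g) (hg2 : MemLp (fun ω => g (X ω)) 2 Q) {C : ℝ}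
    (hC : ∀ᵐ ω ∂Q, C ≤ (Q[fun ω' => (Y ω' - (Q[Y | mE.comap X]) ω') ^ 2 | mE.comap X]) ω) :
    ∀ᵐ ω ∂Q, C ≤ (Q[fun ω' => (Y ω' - g (X ω')) ^ 2 | mE.comap X]) ω := by
  have hgm : StronglyMeasurable[mE.comap X] fun ω => g (X ω) :=
    (hg.comp (comap_measurable X)).stronglyMeasurable
  have hsub : Q[Y - fun ω => g (X ω) | mE.comap X] =ᵐ[Q]
      Q[Y | mE.comap X] - fun ω => g (X ω) := by
    have h := condExp_sub (hY.integrable (by norm_num)) (hg2.integrable (by norm_num))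
      (mE.comap X)
    rwa [condExp_of_stronglyMeasurable hX.comap_le hgm (hg2.integrable (by norm_num))] at h
  have hcongr : Q[fun ω' => (Y ω' - (Q[Y | mE.comap X]) ω') ^ 2 | mE.comap X] =ᵐ[Q]
      Var[Y - fun ω => g (X ω); Q | mE.comap X] := by
    refine condExp_congr_ae ?_
    filter_upwards [hsub] with ω hω
    simp only [Pi.pow_apply, Pi.sub_apply, hω]
    ring
  filter_upwards [hC, hcongr, condVar_ae_le_condExp_sq hX.comap_le (hY.sub hg2)] with ω h1 h2 h3
  exact h1.trans (h2.le.trans h3)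

end CondMoments

/-! ### Inverse propensity weighting -/

namespace DataPoint

variable {p : ℕ}

theorem measurable_R : Measurable (R : DataPoint p → ℝ) :=
  (measurable_of_countable fun b : Bool => if b then (1 : ℝ) else 0).comp measurable_fst

theorem measurable_Y : Measurable (Y : DataPoint p → ℝ) := measurable_fst.comp measurable_snd

theorem measurable_observed : Measurable (observed : DataPoint p → DataPoint p) :=
  measurable_fst.prodMk ((measurable_R.mul measurable_Y).prodMk measurable_X)

theorem R_nonneg (z : DataPoint p) : 0 ≤ R z := by
  unfold R; split <;> norm_num

theorem R_sq (z : DataPoint p) : R z ^ 2 = R z := by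
  unfold R; split <;> norm_num

theorem R_eq_indicator : (R : DataPoint p → ℝ) = (R ⁻¹' {1}).indicator fun _ => 1 := by
  funext z
  by_cases h : R z = 1
  · rw [Set.indicator_of_mem (by exact h), h]
  · rw [Set.indicator_of_notMem (by exact h)]
    unfold R at h ⊢
    split <;> simp_all

theorem integrable_R (Q : Measure (DataPoint p)) [IsFiniteMeasure Q] : Integrable R Q :=
  Integrable.of_bound measurable_R.aestronglyMeasurable 1 (ae_of_all _ fun z => by
    unfold R; split <;> norm_num)

end DataPoint

/-- `π` is the propensity score of the law `Q` of `(R, Y, X)`, and the labels are missing at random: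
`π(X) = E[R | X]`, and `R` and `Y` are conditionally independent given `X`. -/
structure IsPropensity {p : ℕ} (Q : Measure (DataPoint p)) [IsProbabilityMeasure Q]
    (π : (Fin p → ℝ) → ℝ) : Prop where
  measurable : Measurable π
  condExp_eq : (fun z => π (X z)) =ᵐ[Q] Q[R | sigmaX p]
  condIndep : CondIndepFun (sigmaX p) measurable_X.comap_le R Y Q

namespace IsPropensity

variable {p : ℕ} {Q : Measure (DataPoint p)} [IsProbabilityMeasure Q] {π : (Fin p → ℝ) → ℝ}

theorem ae_nonneg (h : IsPropensity Q π) : ∀ᵐ z ∂Q, 0 ≤ π (X z) := by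
  filter_upwards [h.condExp_eq, condExp_nonneg (m := sigmaX p) (ae_of_all Q R_nonneg)] with z h1 h2
  rw [h1]
  exact h2

theorem ae_le_one (h : IsPropensity Q π) : ∀ᵐ z ∂Q, π (X z) ≤ 1 := by
  have hle : R ≤ᵐ[Q] fun _ => (1 : ℝ) := ae_of_all _ fun z => by
    unfold R; split <;> norm_num
  have h1 := condExp_mono (m := sigmaX p) (integrable_R Q) (integrable_const 1) hle
  rw [condExp_const measurable_X.comap_le] at h1
  filter_upwards [h.condExp_eq, h1] with z h2 h3
  rw [h2]
  exact h3

/-- `E[R ; Y ∈ A, X ∈ B] = E[π(X) ; Y ∈ A, X ∈ B]`: by conditional independence,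
`E[R 1_A(Y) | X] = π(X) P(Y ∈ A | X)`. -/
theorem setIntegral_R_eq (h : IsPropensity Q π) {A : Set ℝ} {B : Set (Fin p → ℝ)}
    (hA : MeasurableSet A) (hB : MeasurableSet B) :
    ∫ z in (fun z => (Y z, X z)) ⁻¹' (A ×ˢ B), R z ∂Q =
      ∫ z in (fun z => (Y z, X z)) ⁻¹' (A ×ˢ B), π (X z) ∂Q := by
  have hm := (measurable_X (p := p)).comap_le
  have hYA : MeasurableSet ((Y : DataPoint p → ℝ) ⁻¹' A) := measurable_Y hA
  have hXB : MeasurableSet ((X : DataPoint p → Fin p → ℝ) ⁻¹' B) := measurable_X hB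
  have hset : (fun z : DataPoint p => (Y z, X z)) ⁻¹' (A ×ˢ B) = X ⁻¹' B ∩ Y ⁻¹' A := by
    ext z; simp [and_comm]
  have hπi : Integrable (fun z => π (X z)) Q := integrable_condExp.congr h.condExp_eq.symm
  have hπm : StronglyMeasurable[sigmaX p] fun z => π (X z) :=
    (h.measurable.comp (comap_measurable X)).stronglyMeasurable
  have hind : Integrable ((Y ⁻¹' A).indicator fun _ : DataPoint p => (1 : ℝ)) Q :=
    (integrable_const 1).indicator hYA
  have hprod : (fun z => π (X z)) * ((Y ⁻¹' A).indicator fun _ : DataPoint p => (1 : ℝ)) =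
      (Y ⁻¹' A).indicator fun z => π (X z) := by
    funext z
    by_cases hz : z ∈ Y ⁻¹' A
    · rw [Pi.mul_apply, Set.indicator_of_mem hz, Set.indicator_of_mem hz, mul_one]
    · rw [Pi.mul_apply, Set.indicator_of_notMem hz, Set.indicator_of_notMem hz, mul_zero]
  have hRprod : (Y ⁻¹' A).indicator R =
      (R ⁻¹' {1} ∩ Y ⁻¹' A).indicator fun _ : DataPoint p => (1 : ℝ) := by
    rw [Set.inter_comm, ← Set.indicator_indicator, ← R_eq_indicator]
  have hci := (condIndepFun_iff_condExp_inter_preimage_eq_mul measurable_R measurable_Y).1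
    h.condIndep {1} A (measurableSet_singleton 1) hA
  rw [← hRprod, ← R_eq_indicator] at hci
  have hpull := condExp_mul_of_stronglyMeasurable_left hπm
    (by rw [hprod]; exact hπi.indicator hYA) hind
  rw [hprod] at hpull
  rw [hset, ← setIntegral_indicator hYA, ← setIntegral_indicator hYA,
    ← setIntegral_condExp hm ((integrable_R Q).indicator hYA) ⟨B, hB, rfl⟩,
    ← setIntegral_condExp hm (hπi.indicator hYA) ⟨B, hB, rfl⟩]
  refine setIntegral_congr_ae hXB ?_
  filter_upwards [hci, hpull, h.condExp_eq] with z h1 h2 h3 _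
  rw [h1, h2, Pi.mul_apply, h3]

/-- Weighting by `R` and weighting by `π(X)` give `(Y, X)` the same law. -/
theorem map_withDensity_R_eq (h : IsPropensity Q π) :
    (Q.withDensity fun z => ENNReal.ofReal (R z)).map (fun z => (Y z, X z)) =
      (Q.withDensity fun z => ENNReal.ofReal (π (X z))).map (fun z => (Y z, X z)) := by
  have hYX : Measurable fun z : DataPoint p => (Y z, X z) := measurable_Y.prodMk measurable_X
  have hπi : Integrable (fun z => π (X z)) Q := integrable_condExp.congr h.condExp_eq.symm
  have : IsFiniteMeasure (Q.withDensity fun z => ENNReal.ofReal (R z)) :=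
    isFiniteMeasure_withDensity_ofReal (integrable_R Q).2
  refine Measure.ext_prod fun {A B} hA hB => ?_
  have hAB := hA.prod hB
  rw [Measure.map_apply hYX hAB, Measure.map_apply hYX hAB, withDensity_apply _ (hYX hAB),
    withDensity_apply _ (hYX hAB),
    ← ofReal_integral_eq_lintegral_ofReal (integrable_R Q).integrableOn (ae_of_all _ R_nonneg),
    ← ofReal_integral_eq_lintegral_ofReal hπi.integrableOn (ae_restrict_of_ae h.ae_nonneg),
    h.setIntegral_R_eq hA hB]

theorem lintegral_R_mul (h : IsPropensity Q π) {F : ℝ × (Fin p → ℝ) → ℝ≥0∞} (hF : Measurable F) :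
    ∫⁻ z, ENNReal.ofReal (R z) * F (Y z, X z) ∂Q =
      ∫⁻ z, ENNReal.ofReal (π (X z)) * F (Y z, X z) ∂Q := by
  have hYX : Measurable fun z : DataPoint p => (Y z, X z) := measurable_Y.prodMk measurable_X
  have hFYX : Measurable fun z : DataPoint p => F (Y z, X z) := hF.comp hYX
  have hπX : Measurable fun z : DataPoint p => π (X z) := h.measurable.comp measurable_X
  have h1 := congrArg (fun ν => ∫⁻ x, F x ∂ν) h.map_withDensity_R_eq
  rw [lintegral_map hF hYX, lintegral_map hF hYX,
    lintegral_withDensity_eq_lintegral_mul _ measurable_R.ennreal_ofReal hFYX,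
    lintegral_withDensity_eq_lintegral_mul _ hπX.ennreal_ofReal hFYX] at h1
  exact h1

theorem integral_R_mul (h : IsPropensity Q π) {F : ℝ × (Fin p → ℝ) → ℝ} (hF : Measurable F) :
    ∫ z, R z * F (Y z, X z) ∂Q = ∫ z, π (X z) * F (Y z, X z) ∂Q := by
  have hYX : Measurable fun z : DataPoint p => (Y z, X z) := measurable_Y.prodMk measurable_X
  have hπX : Measurable fun z : DataPoint p => π (X z) := h.measurable.comp measurable_X
  have h1 := congrArg (fun ν => ∫ x, F x ∂ν) h.map_withDensity_R_eq
  rw [integral_map hYX.aemeasurable hF.aestronglyMeasurable,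
    integral_map hYX.aemeasurable hF.aestronglyMeasurable,
    integral_withDensity_eq_integral_toReal_smul measurable_R.ennreal_ofReal
      (ae_of_all _ fun _ => ENNReal.ofReal_lt_top),
    integral_withDensity_eq_integral_toReal_smul hπX.ennreal_ofReal
      (ae_of_all _ fun _ => ENNReal.ofReal_lt_top)] at h1
  have e1 : ∀ z : DataPoint p, (ENNReal.ofReal (R z)).toReal • F (Y z, X z) =
      R z * F (Y z, X z) := fun z => by rw [ENNReal.toReal_ofReal (R_nonneg z), smul_eq_mul]
  simp_rw [e1] at h1
  rw [h1]
  refine integral_congr_ae ?_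
  filter_upwards [h.ae_nonneg] with z hz
  rw [ENNReal.toReal_ofReal hz, smul_eq_mul]

end IsPropensity

/-! ### The effective labelling rate -/

section EffRate

variable {p : ℕ} {Q : Measure (DataPoint p)} {π : (Fin p → ℝ) → ℝ}

theorem effRate_nonneg (Q : Measure (DataPoint p)) (π : (Fin p → ℝ) → ℝ) : 0 ≤ effRate Q π :=
  ENNReal.toReal_nonneg

/-- `effRate` is the inverse in `[0, ∞]`, so a positive effective rate excludes the value `∞` of
`E[1 / π(X)]`. -/
theorem lintegral_inv_ne_top_of_effRate_pos (ha : 0 < effRate Q π) :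
    ∫⁻ z, (ENNReal.ofReal (π (X z)))⁻¹ ∂Q ≠ ⊤ := by
  intro h
  simp [effRate, h] at ha

theorem ae_pos_of_effRate_pos (hπ : Measurable π) (ha : 0 < effRate Q π) :
    ∀ᵐ z ∂Q, 0 < π (X z) := by
  have hm : Measurable fun z : DataPoint p => (ENNReal.ofReal (π (X z)))⁻¹ :=
    (hπ.comp measurable_X).ennreal_ofReal.inv
  filter_upwards [ae_lt_top hm (lintegral_inv_ne_top_of_effRate_pos ha)] with z hz
  simpa using hz

theorem integrable_inv_of_effRate_pos (hπ : Measurable π) (ha : 0 < effRate Q π) :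
    Integrable (fun z => (π (X z))⁻¹) Q := by
  refine ⟨(hπ.comp measurable_X).inv.aestronglyMeasurable, ?_⟩
  rw [hasFiniteIntegral_iff_enorm, lintegral_congr_ae (g := fun z => (ENNReal.ofReal (π (X z)))⁻¹)]
  · exact (lintegral_inv_ne_top_of_effRate_pos ha).lt_top
  · filter_upwards [ae_pos_of_effRate_pos hπ ha] with z hz
    rw [Real.enorm_of_nonneg (inv_nonneg.2 hz.le), ENNReal.ofReal_inv_of_pos hz]

theorem integral_inv_eq_inv_effRate (hπ : Measurable π) (ha : 0 < effRate Q π) :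
    ∫ z, (π (X z))⁻¹ ∂Q = (effRate Q π)⁻¹ := by
  have hpos := ae_pos_of_effRate_pos hπ ha
  rw [integral_eq_lintegral_of_nonneg_ae (hpos.mono fun z hz => inv_nonneg.2 hz.le)
    (hπ.comp measurable_X).inv.aestronglyMeasurable,
    lintegral_congr_ae (g := fun z => (ENNReal.ofReal (π (X z)))⁻¹)]
  · rw [effRate, ENNReal.toReal_inv, inv_inv]
  · filter_upwards [hpos] with z hz
    rw [ENNReal.ofReal_inv_of_pos hz]

end EffRate

namespace IsPropensity

variable {p : ℕ} {Q : Measure (DataPoint p)} [IsProbabilityMeasure Q] {π μ : (Fin p → ℝ) → ℝ}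

/-! ### Moments of inverse propensity weighted variables -/

/-- A weighted variable `R / π(X) * F(Y, X)` has the mean of `F(Y, X)`. -/
theorem integral_ipw (h : IsPropensity Q π) (ha : 0 < effRate Q π) {F : ℝ × (Fin p → ℝ) → ℝ}
    (hF : Measurable F) : ∫ z, R z / π (X z) * F (Y z, X z) ∂Q = ∫ z, F (Y z, X z) ∂Q := by
  have hm : Measurable fun x : ℝ × (Fin p → ℝ) => (π x.2)⁻¹ * F x :=
    (h.measurable.comp measurable_snd).inv.mul hF
  have h1 := h.integral_R_mul hm
  calc _ = ∫ z, R z * ((π (X z))⁻¹ * F (Y z, X z)) ∂Q := by simp_rw [div_eq_mul_inv, mul_assoc]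
    _ = _ := h1
    _ = _ := by
      refine integral_congr_ae ?_
      filter_upwards [ae_pos_of_effRate_pos h.measurable ha] with z hz
      field_simp

theorem integral_ipw_sq (h : IsPropensity Q π) (ha : 0 < effRate Q π) {F : ℝ × (Fin p → ℝ) → ℝ}
    (hF : Measurable F) :
    ∫ z, (R z / π (X z) * F (Y z, X z)) ^ 2 ∂Q = ∫ z, (π (X z))⁻¹ * F (Y z, X z) ^ 2 ∂Q := by
  have hm : Measurable fun x : ℝ × (Fin p → ℝ) => (π x.2)⁻¹ * F x ^ 2 :=
    (h.measurable.comp measurable_snd).inv.mul (hF.pow_const 2)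
  rw [← h.integral_ipw ha hm]
  refine integral_congr_ae (ae_of_all _ fun z => ?_)
  simp only
  rw [mul_pow, div_pow, R_sq]
  ring

theorem memLp_ipw (h : IsPropensity Q π) (ha : 0 < effRate Q π) {F : ℝ × (Fin p → ℝ) → ℝ}
    (hF : Measurable F) (hint : Integrable (fun z => (π (X z))⁻¹ * F (Y z, X z) ^ 2) Q) :
    MemLp (fun z => R z / π (X z) * F (Y z, X z)) 2 Q := by
  have hYX : Measurable fun z : DataPoint p => (Y z, X z) := measurable_Y.prodMk measurable_X
  have hmeas : Measurable fun z => R z / π (X z) * F (Y z, X z) :=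
    (measurable_R.div (h.measurable.comp measurable_X)).mul (hF.comp hYX)
  rw [memLp_two_iff_integrable_sq hmeas.aestronglyMeasurable]
  refine ⟨(hmeas.pow_const 2).aestronglyMeasurable, ?_⟩
  have hm : Measurable fun x : ℝ × (Fin p → ℝ) => ENNReal.ofReal (((π x.2)⁻¹ * F x) ^ 2) :=
    (((h.measurable.comp measurable_snd).inv.mul hF).pow_const 2).ennreal_ofReal
  have h1 := h.lintegral_R_mul hm
  have hfin := hint.2
  rw [hasFiniteIntegral_iff_enorm] at hfin ⊢
  have e1 : ∫⁻ z, ‖(R z / π (X z) * F (Y z, X z)) ^ 2‖ₑ ∂Q =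
      ∫⁻ z, ENNReal.ofReal (R z) * ENNReal.ofReal (((π (X z))⁻¹ * F (Y z, X z)) ^ 2) ∂Q := by
    refine lintegral_congr fun z => ?_
    rw [Real.enorm_of_nonneg (sq_nonneg _), ← ENNReal.ofReal_mul (R_nonneg z), mul_pow, div_pow,
      R_sq]
    congr 1
    ring
  have e2 : ∫⁻ z, ‖(π (X z))⁻¹ * F (Y z, X z) ^ 2‖ₑ ∂Q =
      ∫⁻ z, ENNReal.ofReal (π (X z)) * ENNReal.ofReal (((π (X z))⁻¹ * F (Y z, X z)) ^ 2) ∂Q := by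
    refine lintegral_congr_ae ?_
    filter_upwards [ae_pos_of_effRate_pos h.measurable ha] with z hz
    rw [Real.enorm_of_nonneg (by positivity), ← ENNReal.ofReal_mul hz.le]
    congr 1
    field_simp
  rw [e1, h1, ← e2]
  exact hfin

theorem integrable_sq_of_integrable_inv_mul_sq (h : IsPropensity Q π) (ha : 0 < effRate Q π)
    {F : ℝ × (Fin p → ℝ) → ℝ} (hF : Measurable F)
    (hint : Integrable (fun z => (π (X z))⁻¹ * F (Y z, X z) ^ 2) Q) :
    Integrable (fun z => F (Y z, X z) ^ 2) Q := by
  have hYX : Measurable fun z : DataPoint p => (Y z, X z) := measurable_Y.prodMk measurable_X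
  refine hint.mono' ((hF.comp hYX).pow_const 2).aestronglyMeasurable ?_
  filter_upwards [ae_pos_of_effRate_pos h.measurable ha, h.ae_le_one] with z h0 h1
  rw [Real.norm_of_nonneg (sq_nonneg _)]
  exact le_mul_of_one_le_left (sq_nonneg _) ((one_le_inv₀ h0).2 h1)

/-- The summand of the cross-fitting remainder: `(1 - R / π(X)) g(X)` is centred, and its second
moment is at most `E[g(X)² / π(X)]`. -/
theorem memLp_one_sub_ipw_mul (h : IsPropensity Q π) (ha : 0 < effRate Q π) {g : (Fin p → ℝ) → ℝ}
    (hg : Measurable g) (hint : Integrable (fun z => (π (X z))⁻¹ * g (X z) ^ 2) Q) :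
    MemLp (fun z => (1 - R z / π (X z)) * g (X z)) 2 Q ∧
      ∫ z, (1 - R z / π (X z)) * g (X z) ∂Q = 0 ∧
      ∫ z, ((1 - R z / π (X z)) * g (X z)) ^ 2 ∂Q ≤ ∫ z, (π (X z))⁻¹ * g (X z) ^ 2 ∂Q := by
  have hgm : Measurable fun x : ℝ × (Fin p → ℝ) => g x.2 := hg.comp measurable_snd
  have hL2 : MemLp (fun z : DataPoint p => g (X z)) 2 Q := by
    have hgX : Measurable fun z : DataPoint p => g (X z) := hg.comp measurable_X
    rw [memLp_two_iff_integrable_sq hgX.aestronglyMeasurable]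
    exact h.integrable_sq_of_integrable_inv_mul_sq ha hgm hint
  have hipw : MemLp (fun z => R z / π (X z) * g (X z)) 2 Q := h.memLp_ipw ha hgm hint
  have hfun : (fun z => (1 - R z / π (X z)) * g (X z)) =
      fun z => g (X z) - R z / π (X z) * g (X z) := by
    funext z; ring
  refine ⟨by rw [hfun]; exact hL2.sub hipw, ?_, ?_⟩
  · rw [hfun, integral_sub (hL2.integrable (by norm_num)) (hipw.integrable (by norm_num)),
      h.integral_ipw ha hgm, sub_self]
  · have hcross : Integrable (fun z => R z / π (X z) * g (X z) ^ 2) Q := by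
      refine (hipw.integrable_mul hL2).congr (ae_of_all _ fun z => ?_)
      simp only [Pi.mul_apply]
      ring
    have hcross' : ∫ z, R z / π (X z) * g (X z) ^ 2 ∂Q = ∫ z, g (X z) ^ 2 ∂Q :=
      h.integral_ipw ha (hgm.pow_const 2)
    have e1 : ∫ z, ((1 - R z / π (X z)) * g (X z)) ^ 2 ∂Q =
        ∫ z, (g (X z) ^ 2 - 2 * (R z / π (X z) * g (X z) ^ 2) +
          (R z / π (X z) * g (X z)) ^ 2) ∂Q := by
      congr 1 with z; ring
    have hsub : Integrable (fun z => g (X z) ^ 2 - 2 * (R z / π (X z) * g (X z) ^ 2)) Q :=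
      hL2.integrable_sq.sub (hcross.const_mul 2)
    rw [e1, integral_add hsub hipw.integrable_sq,
      integral_sub hL2.integrable_sq (hcross.const_mul 2), integral_const_mul, hcross',
      h.integral_ipw_sq ha hgm]
    have : 0 ≤ ∫ z, g (X z) ^ 2 ∂Q := integral_nonneg fun z => sq_nonneg _
    linarith

end IsPropensity

/-! ### Variances of the influence functions -/

/-- The moment conditions on the outcome and on the working regression function `μ`: the residual
variance of `Y` given `X` is at least `σ₁²`, and the conditional mean squared error of `μ` and the
variance of `Y` are at most `σ₂²`. -/
structure OutcomeBounds {p : ℕ} (Q : Measure (DataPoint p)) [IsProbabilityMeasure Q]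
    (μ : (Fin p → ℝ) → ℝ) (σ₁ σ₂ : ℝ) : Prop where
  measurable : Measurable μ
  memLp_Y : MemLp Y 2 Q
  le_condExp : ∀ᵐ z ∂Q, σ₁ ^ 2 ≤
    (Q[fun z' => (Y z' - (Q[Y | sigmaX p]) z') ^ 2 | sigmaX p]) z
  integrable_sq : Integrable (fun z => (Y z - μ (X z)) ^ 2) Q
  condExp_le : ∀ᵐ z ∂Q, (Q[fun z' => (Y z' - μ (X z')) ^ 2 | sigmaX p]) z ≤ σ₂ ^ 2
  variance_Y_le : Var[Y; Q] ≤ σ₂ ^ 2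

namespace OutcomeBounds

variable {p : ℕ} {Q : Measure (DataPoint p)} [IsProbabilityMeasure Q] {π μ : (Fin p → ℝ) → ℝ}
  {σ₁ σ₂ : ℝ}

theorem measurable_residual (hb : OutcomeBounds Q μ σ₁ σ₂) :
    Measurable fun z : DataPoint p => Y z - μ (X z) :=
  measurable_Y.sub (hb.measurable.comp measurable_X)

theorem measurable_uncurry_residual (hb : OutcomeBounds Q μ σ₁ σ₂) :
    Measurable fun x : ℝ × (Fin p → ℝ) => x.1 - μ x.2 :=
  measurable_fst.sub (hb.measurable.comp measurable_snd)

theorem memLp_residual (hb : OutcomeBounds Q μ σ₁ σ₂) : MemLp (fun z => Y z - μ (X z)) 2 Q :=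
  (memLp_two_iff_integrable_sq hb.measurable_residual.aestronglyMeasurable).2 hb.integrable_sq

theorem memLp_regression (hb : OutcomeBounds Q μ σ₁ σ₂) : MemLp (fun z => μ (X z)) 2 Q := by
  refine (hb.memLp_Y.sub hb.memLp_residual).ae_eq (ae_of_all _ fun z => ?_)
  simp

theorem integral_residual_sq_le (hb : OutcomeBounds Q μ σ₁ σ₂) :
    ∫ z, (Y z - μ (X z)) ^ 2 ∂Q ≤ σ₂ ^ 2 := by
  have h := integral_weight_mul_le_of_condExp_le measurable_X hb.integrable_sq hb.condExp_le
    (w := fun _ => 1) measurable_const (ae_of_all _ fun _ => zero_le_one) (integrable_const _)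
    (by simpa using hb.integrable_sq)
  simpa using h

/-- The conditional variance of `Y` is not affected by subtracting a function of `X`, so it bounds
the variance of every `Y - g(X)` from below. -/
theorem le_variance_sub (hb : OutcomeBounds Q μ σ₁ σ₂) {g : (Fin p → ℝ) → ℝ} (hg : Measurable g)
    (hg2 : MemLp (fun z => g (X z)) 2 Q) : σ₁ ^ 2 ≤ Var[fun z => Y z - g (X z); Q] := by
  set c := ∫ z, (Y z - g (X z)) ∂Q with hc
  have hm : Measurable fun z : DataPoint p => Y z - g (X z) :=
    measurable_Y.sub (hg.comp measurable_X)
  have hgc : MemLp (fun z => g (X z) + c) 2 Q := hg2.add (memLp_const c)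
  have hsq : Integrable (fun z => (Y z - (g (X z) + c)) ^ 2) Q :=
    (hb.memLp_Y.sub hgc).integrable_sq
  have hlow := le_condExp_sq_sub_of_le_condExp_sq_sub_condExp measurable_X hb.memLp_Y
    (g := fun x => g x + c) (hg.add_const c) hgc hb.le_condExp
  have h := le_integral_weight_mul_of_le_condExp measurable_X hsq hlow
    (w := fun _ => 1) measurable_const (ae_of_all _ fun _ => zero_le_one) (integrable_const _)
    (by simpa using hsq)
  rw [variance_eq_integral hm.aemeasurable]
  simpa [← hc, sub_sub] using h

theorem le_variance_Y (hb : OutcomeBounds Q μ σ₁ σ₂) : σ₁ ^ 2 ≤ Var[Y; Q] := by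
  have h := hb.le_variance_sub (g := fun _ => 0) measurable_const (memLp_const _)
  simpa using h

theorem integrable_inv_mul_residual_sq (hb : OutcomeBounds Q μ σ₁ σ₂) (h : IsPropensity Q π)
    (ha : 0 < effRate Q π) : Integrable (fun z => (π (X z))⁻¹ * (Y z - μ (X z)) ^ 2) Q :=
  integrable_weight_mul_of_condExp_le measurable_X (hb.measurable_residual.pow_const 2)
    hb.integrable_sq (fun _ => sq_nonneg _) hb.condExp_le (w := fun x => (π x)⁻¹)
    h.measurable.inv (integrable_inv_of_effRate_pos h.measurable ha)

theorem integral_inv_mul_residual_sq_sub_bounds (hb : OutcomeBounds Q μ σ₁ σ₂)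
    (h : IsPropensity Q π) (ha : 0 < effRate Q π) :
    σ₁ ^ 2 * ((effRate Q π)⁻¹ - 1) ≤
        ∫ z, (π (X z))⁻¹ * (Y z - μ (X z)) ^ 2 ∂Q - ∫ z, (Y z - μ (X z)) ^ 2 ∂Q ∧
      ∫ z, (π (X z))⁻¹ * (Y z - μ (X z)) ^ 2 ∂Q - ∫ z, (Y z - μ (X z)) ^ 2 ∂Q ≤
        σ₂ ^ 2 * ((effRate Q π)⁻¹ - 1) := by
  have hinv := integrable_inv_of_effRate_pos h.measurable ha
  have hA := hb.integrable_inv_mul_residual_sq h ha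
  have hw0 : ∀ᵐ z ∂Q, 0 ≤ (π (X z))⁻¹ - 1 := by
    filter_upwards [ae_pos_of_effRate_pos h.measurable ha, h.ae_le_one] with z h0 h1
    exact sub_nonneg.2 ((one_le_inv₀ h0).2 h1)
  have hwm : Measurable fun x => (π x)⁻¹ - 1 := h.measurable.inv.sub_const 1
  have hwi : Integrable (fun z => (π (X z))⁻¹ - 1) Q := hinv.sub (integrable_const 1)
  have hwint : ∫ z, ((π (X z))⁻¹ - 1) ∂Q = (effRate Q π)⁻¹ - 1 := by
    rw [integral_sub hinv (integrable_const 1), integral_inv_eq_inv_effRate h.measurable ha]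
    simp
  have hfun : (fun z : DataPoint p => ((π (X z))⁻¹ - 1) * (Y z - μ (X z)) ^ 2) =
      fun z => (π (X z))⁻¹ * (Y z - μ (X z)) ^ 2 - (Y z - μ (X z)) ^ 2 := by
    funext z; ring
  have hwG : Integrable (fun z => ((π (X z))⁻¹ - 1) * (Y z - μ (X z)) ^ 2) Q := by
    rw [hfun]; exact hA.sub hb.integrable_sq
  have hval : ∫ z, ((π (X z))⁻¹ - 1) * (Y z - μ (X z)) ^ 2 ∂Q =
      ∫ z, (π (X z))⁻¹ * (Y z - μ (X z)) ^ 2 ∂Q - ∫ z, (Y z - μ (X z)) ^ 2 ∂Q := by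
    rw [hfun, integral_sub hA hb.integrable_sq]
  have hlow := le_condExp_sq_sub_of_le_condExp_sq_sub_condExp measurable_X hb.memLp_Y
    hb.measurable hb.memLp_regression hb.le_condExp
  have h1 := le_integral_weight_mul_of_le_condExp measurable_X hb.integrable_sq hlow
    (w := fun x => (π x)⁻¹ - 1) hwm hw0 hwi hwG
  have h2 := integral_weight_mul_le_of_condExp_le measurable_X hb.integrable_sq hb.condExp_le
    (w := fun x => (π x)⁻¹ - 1) hwm hw0 hwi hwG
  rw [hwint, hval] at h1 h2
  exact ⟨h1, h2⟩

theorem memLp_ipw_residual (hb : OutcomeBounds Q μ σ₁ σ₂) (h : IsPropensity Q π)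
    (ha : 0 < effRate Q π) : MemLp (fun z => R z / π (X z) * (Y z - μ (X z))) 2 Q :=
  h.memLp_ipw ha hb.measurable_uncurry_residual (hb.integrable_inv_mul_residual_sq h ha)

theorem memLp_psi (hb : OutcomeBounds Q μ σ₁ σ₂) (h : IsPropensity Q π)
    (ha : 0 < effRate Q π) : MemLp (psi Q π μ) 2 Q :=
  (hb.memLp_regression.add (hb.memLp_ipw_residual h ha)).sub (memLp_const _)

theorem memLp_psiTilde (hb : OutcomeBounds Q μ σ₁ σ₂) (h : IsPropensity Q π)
    (ha : 0 < effRate Q π) : MemLp (psiTilde Q π μ) 2 Q :=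
  (hb.memLp_ipw_residual h ha).sub (memLp_const _)

theorem integral_ipw_residual (hb : OutcomeBounds Q μ σ₁ σ₂) (h : IsPropensity Q π)
    (ha : 0 < effRate Q π) :
    ∫ z, R z / π (X z) * (Y z - μ (X z)) ∂Q = ∫ z, (Y z - μ (X z)) ∂Q :=
  h.integral_ipw ha hb.measurable_uncurry_residual

theorem integral_psi (hb : OutcomeBounds Q μ σ₁ σ₂) (h : IsPropensity Q π)
    (ha : 0 < effRate Q π) : ∫ z, psi Q π μ z ∂Q = 0 := by
  have hμi : Integrable (fun z => μ (X z)) Q := hb.memLp_regression.integrable (by norm_num)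
  have hwi : Integrable (fun z => R z / π (X z) * (Y z - μ (X z))) Q :=
    (hb.memLp_ipw_residual h ha).integrable (by norm_num)
  have hsum : Integrable (fun z => μ (X z) + R z / π (X z) * (Y z - μ (X z))) Q := hμi.add hwi
  unfold psi
  rw [integral_sub hsum (integrable_const _), integral_add hμi hwi, hb.integral_ipw_residual h ha,
    integral_sub (hb.memLp_Y.integrable (by norm_num)) hμi, integral_const, meanOutcome]
  simp

theorem integral_psiTilde (hb : OutcomeBounds Q μ σ₁ σ₂) (h : IsPropensity Q π)
    (ha : 0 < effRate Q π) : ∫ z, psiTilde Q π μ z ∂Q = 0 := by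
  unfold psiTilde
  rw [integral_sub ((hb.memLp_ipw_residual h ha).integrable (by norm_num)) (integrable_const _)]
  simp

theorem variance_psiTilde (hb : OutcomeBounds Q μ σ₁ σ₂) (h : IsPropensity Q π)
    (ha : 0 < effRate Q π) : Var[psiTilde Q π μ; Q] =
      ∫ z, (π (X z))⁻¹ * (Y z - μ (X z)) ^ 2 ∂Q - (∫ z, (Y z - μ (X z)) ∂Q) ^ 2 := by
  have hL := hb.memLp_ipw_residual h ha
  unfold psiTilde
  rw [variance_sub_const hL.aestronglyMeasurable, variance_eq_sub hL,
    hb.integral_ipw_residual h ha]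
  congr 1
  exact h.integral_ipw_sq ha hb.measurable_uncurry_residual

/-- In `ψ = (Y - θ₀) + (R / π(X) - 1) (Y - μ(X))` the two terms are uncorrelated, because `R` and
`Y` are conditionally independent and `R / π(X)` has conditional mean one. -/
theorem variance_psi (hb : OutcomeBounds Q μ σ₁ σ₂) (h : IsPropensity Q π)
    (ha : 0 < effRate Q π) : Var[psi Q π μ; Q] = Var[Y; Q] +
      (∫ z, (π (X z))⁻¹ * (Y z - μ (X z)) ^ 2 ∂Q - ∫ z, (Y z - μ (X z)) ^ 2 ∂Q) := by
  have hD := hb.memLp_residual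
  have hU := hb.memLp_ipw_residual h ha
  have hY0 : MemLp (fun z => Y z - meanOutcome Q) 2 Q := hb.memLp_Y.sub (memLp_const _)
  have hYD : Integrable (fun z => (Y z - meanOutcome Q) * (Y z - μ (X z))) Q :=
    hY0.integrable_mul hD
  have hYU : Integrable (fun z => R z / π (X z) * ((Y z - meanOutcome Q) * (Y z - μ (X z)))) Q := by
    refine (hY0.integrable_mul hU).congr (ae_of_all _ fun z => ?_)
    simp only [Pi.mul_apply]
    ring
  have hDU : Integrable (fun z => R z / π (X z) * (Y z - μ (X z)) ^ 2) Q := by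
    refine (hD.integrable_mul hU).congr (ae_of_all _ fun z => ?_)
    simp only [Pi.mul_apply]
    ring
  have e1 : ∫ z, R z / π (X z) * ((Y z - meanOutcome Q) * (Y z - μ (X z))) ∂Q =
      ∫ z, (Y z - meanOutcome Q) * (Y z - μ (X z)) ∂Q :=
    h.integral_ipw ha (F := fun x => (x.1 - meanOutcome Q) * (x.1 - μ x.2))
      ((measurable_fst.sub_const _).mul hb.measurable_uncurry_residual)
  have e2 : ∫ z, R z / π (X z) * (Y z - μ (X z)) ^ 2 ∂Q = ∫ z, (Y z - μ (X z)) ^ 2 ∂Q :=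
    h.integral_ipw ha (hb.measurable_uncurry_residual.pow_const 2)
  have e3 : ∫ z, (R z / π (X z) * (Y z - μ (X z))) ^ 2 ∂Q =
      ∫ z, (π (X z))⁻¹ * (Y z - μ (X z)) ^ 2 ∂Q :=
    h.integral_ipw_sq ha hb.measurable_uncurry_residual
  have hψ := hb.memLp_psi h ha
  rw [variance_eq_sub hψ, hb.integral_psi h ha, variance_eq_integral measurable_Y.aemeasurable]
  have hfun : ∀ z, (psi Q π μ ^ 2) z = (Y z - meanOutcome Q) ^ 2 + (2 *
      (R z / π (X z) * ((Y z - meanOutcome Q) * (Y z - μ (X z)))) + (-2 *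
      ((Y z - meanOutcome Q) * (Y z - μ (X z))) + ((R z / π (X z) * (Y z - μ (X z))) ^ 2 + (-2 *
      (R z / π (X z) * (Y z - μ (X z)) ^ 2) + (Y z - μ (X z)) ^ 2)))) := by
    intro z
    simp only [Pi.pow_apply, psi]
    ring
  simp_rw [hfun]
  have i5 : Integrable (fun z => -2 * (R z / π (X z) * (Y z - μ (X z)) ^ 2) +
      (Y z - μ (X z)) ^ 2) Q := (hDU.const_mul _).add hb.integrable_sq
  have i4 : Integrable (fun z => (R z / π (X z) * (Y z - μ (X z))) ^ 2 + (-2 *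
      (R z / π (X z) * (Y z - μ (X z)) ^ 2) + (Y z - μ (X z)) ^ 2)) Q := hU.integrable_sq.add i5
  have i3 : Integrable (fun z => -2 *
      ((Y z - meanOutcome Q) * (Y z - μ (X z))) + ((R z / π (X z) * (Y z - μ (X z))) ^ 2 + (-2 *
      (R z / π (X z) * (Y z - μ (X z)) ^ 2) + (Y z - μ (X z)) ^ 2))) Q := (hYD.const_mul _).add i4
  have i2 : Integrable (fun z => 2 *
      (R z / π (X z) * ((Y z - meanOutcome Q) * (Y z - μ (X z)))) + (-2 *
      ((Y z - meanOutcome Q) * (Y z - μ (X z))) + ((R z / π (X z) * (Y z - μ (X z))) ^ 2 + (-2 *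
      (R z / π (X z) * (Y z - μ (X z)) ^ 2) + (Y z - μ (X z)) ^ 2)))) Q :=
    (hYU.const_mul _).add i3
  rw [integral_add hY0.integrable_sq i2, integral_add (hYU.const_mul _) i3,
    integral_add (hYD.const_mul _) i4, integral_add hU.integrable_sq i5,
    integral_add (hDU.const_mul _) hb.integrable_sq, integral_const_mul, integral_const_mul,
    integral_const_mul, e1, e2, e3, meanOutcome]
  ring

theorem variance_psi_bounds (hb : OutcomeBounds Q μ σ₁ σ₂) (h : IsPropensity Q π)
    (ha : 0 < effRate Q π) : σ₁ ^ 2 * (effRate Q π)⁻¹ ≤ Var[psi Q π μ; Q] ∧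
      Var[psi Q π μ; Q] ≤ σ₂ ^ 2 * (effRate Q π)⁻¹ := by
  obtain ⟨h1, h2⟩ := hb.integral_inv_mul_residual_sq_sub_bounds h ha
  have h3 := hb.le_variance_Y
  have h4 := hb.variance_Y_le
  rw [hb.variance_psi h ha]
  constructor <;> nlinarith

theorem variance_psiTilde_bounds (hb : OutcomeBounds Q μ σ₁ σ₂) (h : IsPropensity Q π)
    (ha : 0 < effRate Q π) : σ₁ ^ 2 * (effRate Q π)⁻¹ ≤ Var[psiTilde Q π μ; Q] ∧
      Var[psiTilde Q π μ; Q] ≤ σ₂ ^ 2 * (effRate Q π)⁻¹ := by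
  obtain ⟨h1, h2⟩ := hb.integral_inv_mul_residual_sq_sub_bounds h ha
  have h3 := hb.le_variance_sub hb.measurable hb.memLp_regression
  have h4 := hb.integral_residual_sq_le
  have h5 := variance_eq_sub hb.memLp_residual
  simp only [Pi.pow_apply] at h5
  rw [hb.variance_psiTilde h ha]
  constructor <;> nlinarith [sq_nonneg (∫ z, (Y z - μ (X z)) ∂Q)]

theorem abs_variance_psi_sub_variance_psiTilde_le (hb : OutcomeBounds Q μ σ₁ σ₂)
    (h : IsPropensity Q π) (ha : 0 < effRate Q π) :
    |Var[psi Q π μ; Q] - Var[psiTilde Q π μ; Q]| ≤ σ₂ ^ 2 := by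
  have h4 := hb.integral_residual_sq_le
  have h5 := variance_eq_sub hb.memLp_residual
  have h6 := variance_nonneg (fun z => Y z - μ (X z)) Q
  have h7 := variance_nonneg Y Q
  have h8 := hb.variance_Y_le
  simp only [Pi.pow_apply] at h5
  rw [hb.variance_psi h ha, hb.variance_psiTilde h ha, abs_le]
  constructor <;> nlinarith [sq_nonneg (∫ z, (Y z - μ (X z)) ∂Q)]

theorem variance_regression_le (hb : OutcomeBounds Q μ σ₁ σ₂) :
    Var[fun z => μ (X z); Q] ≤ 4 * σ₂ ^ 2 := by
  have hμ := hb.memLp_regression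
  have h1 : Var[fun z => μ (X z); Q] ≤ ∫ z, (μ (X z) - meanOutcome Q) ^ 2 ∂Q := by
    rw [← variance_sub_const hμ.aestronglyMeasurable (meanOutcome Q)]
    exact variance_le_expectation_sq (hμ.sub (memLp_const _)).aestronglyMeasurable
  have hY0 : Integrable (fun z => (Y z - meanOutcome Q) ^ 2) Q :=
    (hb.memLp_Y.sub (memLp_const _)).integrable_sq
  have h2 : ∫ z, (μ (X z) - meanOutcome Q) ^ 2 ∂Q ≤
      ∫ z, (2 * (Y z - meanOutcome Q) ^ 2 + 2 * (Y z - μ (X z)) ^ 2) ∂Q := by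
    refine integral_mono (hμ.sub (memLp_const _)).integrable_sq
      ((hY0.const_mul 2).add (hb.integrable_sq.const_mul 2)) fun z => ?_
    beta_reduce
    nlinarith [sq_nonneg ((Y z - meanOutcome Q) + (Y z - μ (X z)))]
  rw [integral_add (hY0.const_mul 2) (hb.integrable_sq.const_mul 2), integral_const_mul,
    integral_const_mul] at h2
  have h3 := hb.variance_Y_le
  rw [variance_eq_integral measurable_Y.aemeasurable] at h3
  have h4 := hb.integral_residual_sq_le
  unfold meanOutcome at *
  linarith

end OutcomeBounds

/-! ### The cross-fitted estimator -/

/-- `Z` is an i.i.d. sample from `Q`, and `fold` is a random partition of the indices that is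
independent of the sample. -/
structure IsFoldedSample {p n K : ℕ} {Ω : Type*} [MeasurableSpace Ω] (P : Measure Ω)
    (Q : Measure (DataPoint p)) (Z : Fin n → Ω → DataPoint p) (fold : Ω → Fin n → Fin K) :
    Prop where
  measurable : ∀ i, Measurable (Z i)
  law : ∀ i, P.map (Z i) = Q
  indep : iIndepFun Z P
  measurable_fold : Measurable fold
  indep_fold : IndepFun fold (fun ω i => Z i ω) P

/-- The contribution of the `k`-th fold to the difference between the estimator with estimated and
with limiting regression function. -/
noncomputable def foldRemainder {p n K : ℕ} (π μ : (Fin p → ℝ) → ℝ) (mhat : Learner p n)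
    (fold : Fin n → Fin K) (z : Fin n → DataPoint p) (k : Fin K) : ℝ :=
  (n : ℝ)⁻¹ * ∑ i ∈ (trainIdx fold k)ᶜ, (1 - R (z i) / π (X (z i))) *
    (mhatOut mhat fold z k (X (z i)) - μ (X (z i)))

section Estimator

variable {p n K : ℕ} {Q : Measure (DataPoint p)} {π μ : (Fin p → ℝ) → ℝ} {mhat : Learner p n}

theorem thetaTilde_sub_mean_psi_eq (hn : 0 < n) (fold : Fin n → Fin K) (z : Fin n → DataPoint p) :
    thetaTilde π mhat fold z - meanOutcome Q - (n : ℝ)⁻¹ * ∑ i, psi Q π μ (z i) =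
      ∑ k, foldRemainder π μ mhat fold z k := by
  have hn' : (n : ℝ) ≠ 0 := by exact_mod_cast hn.ne'
  have hcompl : ∀ k, (trainIdx fold k)ᶜ = Finset.univ.filter fun i => fold i = k := fun k => by
    ext i; simp [trainIdx]
  have hsum : ∑ k, ∑ i ∈ (trainIdx fold k)ᶜ, (1 - R (z i) / π (X (z i))) *
      (mhatOut mhat fold z k (X (z i)) - μ (X (z i))) =
      ∑ i, (1 - R (z i) / π (X (z i))) *
        (mhatOut mhat fold z (fold i) (X (z i)) - μ (X (z i))) := by
    rw [← Finset.sum_fiberwise (g := fold)]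
    refine Finset.sum_congr rfl fun k _ => ?_
    rw [hcompl]
    refine Finset.sum_congr rfl fun i hi => ?_
    rw [(Finset.mem_filter.1 hi).2]
  have hθ : meanOutcome Q = (n : ℝ)⁻¹ * ∑ _i : Fin n, meanOutcome Q := by
    rw [Finset.sum_const, Finset.card_univ, Fintype.card_fin, nsmul_eq_mul]
    field_simp
  simp only [foldRemainder]
  rw [← Finset.mul_sum, hsum, thetaTilde]
  nth_rewrite 1 [hθ]
  rw [← mul_add, ← mul_sub, ← mul_sub, ← Finset.sum_add_distrib, ← Finset.sum_sub_distrib,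
    ← Finset.sum_sub_distrib]
  congr 1
  refine Finset.sum_congr rfl fun i _ => ?_
  rw [psi]
  ring

theorem measurable_learner_comp
    (hmhat : ∀ J : Finset (Fin n), Measurable
      (fun q : (J → DataPoint p) × (Fin p → ℝ) => mhat J q.1 q.2)) (J : Finset (Fin n)) :
    Measurable fun q : (J → DataPoint p) × DataPoint p =>
      mhat J (fun j => observed (q.1 j)) (X q.2) := by
  have hobs : Measurable fun q : (J → DataPoint p) × DataPoint p => fun j => observed (q.1 j) :=
    measurable_pi_lambda _ fun j =>
      measurable_observed.comp ((measurable_pi_apply j).comp measurable_fst)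
  have hX : Measurable fun q : (J → DataPoint p) × DataPoint p => X q.2 :=
    measurable_X.comp measurable_snd
  exact (hmhat J).comp (hobs.prodMk hX)

theorem measurable_thetaTilde (hπ : Measurable π)
    (hmhat : ∀ J : Finset (Fin n), Measurable
      (fun q : (J → DataPoint p) × (Fin p → ℝ) => mhat J q.1 q.2)) :
    Measurable fun x : (Fin n → Fin K) × (Fin n → DataPoint p) =>
      thetaTilde π mhat x.1 x.2 := by
  refine measurable_from_prod_countable_right fun f => ?_
  have hm : ∀ i, Measurable fun z : Fin n → DataPoint p =>
      mhatOut mhat f z (f i) (X (z i)) := fun i => by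
    have hdata : Measurable fun z : Fin n → DataPoint p =>
        ((fun j : trainIdx f (f i) => z j), z i) :=
      (measurable_pi_lambda _ fun j => measurable_pi_apply _).prodMk (measurable_pi_apply i)
    exact (measurable_learner_comp hmhat (trainIdx f (f i))).comp hdata
  refine ((Finset.measurable_sum _ fun i _ => hm i).const_mul _).add
    ((Finset.measurable_sum _ fun i _ => ?_).const_mul _)
  have hz : Measurable fun z : Fin n → DataPoint p => z i := measurable_pi_apply i
  exact ((measurable_R.comp hz).div (hπ.comp (measurable_X.comp hz))).mul
    ((measurable_Y.comp hz).sub (hm i))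

end Estimator

/-- The moments of `(1 - R / π(X)) g(X)` when the weighted error of the fold's estimator, which is
the hypothesis with `g = m̂ - μ`, is at most `b`. -/
theorem IsPropensity.ipw_moments_of_lintegral_le {p : ℕ} {Q : Measure (DataPoint p)}
    [IsProbabilityMeasure Q] {π g : (Fin p → ℝ) → ℝ} (h : IsPropensity Q π)
    (ha : 0 < effRate Q π) (hg : Measurable g) {b : ℝ}
    (hle : ∫⁻ z, ENNReal.ofReal (effRate Q π / π (X z) * g (X z) ^ 2) ∂Q ≤ ENNReal.ofReal b) :
    MemLp (fun z => (1 - R z / π (X z)) * g (X z)) 2 Q ∧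
      ∫ z, (1 - R z / π (X z)) * g (X z) ∂Q = 0 ∧
      ∫⁻ z, ‖(1 - R z / π (X z)) * g (X z)‖ₑ ^ 2 ∂Q ≤ ENNReal.ofReal (b / effRate Q π) := by
  have hπX : Measurable fun z : DataPoint p => π (X z) := h.measurable.comp measurable_X
  have hpos := ae_pos_of_effRate_pos h.measurable ha
  have hm2 : Measurable fun z : DataPoint p => (π (X z))⁻¹ * g (X z) ^ 2 :=
    hπX.inv.mul ((hg.comp measurable_X).pow_const 2)
  have hlin : ∫⁻ z, ENNReal.ofReal ((π (X z))⁻¹ * g (X z) ^ 2) ∂Q ≤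
      ENNReal.ofReal (b / effRate Q π) := by
    have e : ∫⁻ z, ENNReal.ofReal (effRate Q π / π (X z) * g (X z) ^ 2) ∂Q =
        ENNReal.ofReal (effRate Q π) *
        ∫⁻ z, ENNReal.ofReal ((π (X z))⁻¹ * g (X z) ^ 2) ∂Q := by
      rw [← lintegral_const_mul _ hm2.ennreal_ofReal]
      refine lintegral_congr fun z => ?_
      rw [← ENNReal.ofReal_mul ha.le]
      congr 1
      ring
    rw [e] at hle
    rw [ENNReal.ofReal_div_of_pos ha, ENNReal.le_div_iff_mul_le
      (.inl (ENNReal.ofReal_pos.2 ha).ne') (.inl ENNReal.ofReal_ne_top), mul_comm]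
    exact hle
  have hnn : 0 ≤ᵐ[Q] fun z => (π (X z))⁻¹ * g (X z) ^ 2 := by
    filter_upwards [hpos] with z hz
    exact mul_nonneg (inv_nonneg.2 hz.le) (sq_nonneg _)
  have hint : Integrable (fun z => (π (X z))⁻¹ * g (X z) ^ 2) Q := by
    refine ⟨hm2.aestronglyMeasurable, ?_⟩
    rw [hasFiniteIntegral_iff_ofReal hnn]
    exact hlin.trans_lt ENNReal.ofReal_lt_top
  obtain ⟨h1, h2, h3⟩ := h.memLp_one_sub_ipw_mul ha hg hint
  refine ⟨h1, h2, ?_⟩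
  calc ∫⁻ z, ‖(1 - R z / π (X z)) * g (X z)‖ₑ ^ 2 ∂Q
      = ∫⁻ z, ENNReal.ofReal (((1 - R z / π (X z)) * g (X z)) ^ 2) ∂Q := by
        refine lintegral_congr fun z => ?_
        rw [← ofReal_norm, ← ENNReal.ofReal_pow (norm_nonneg _), Real.norm_eq_abs, sq_abs]
    _ = ENNReal.ofReal (∫ z, ((1 - R z / π (X z)) * g (X z)) ^ 2 ∂Q) :=
        (ofReal_integral_eq_lintegral_ofReal h1.integrable_sq
          (ae_of_all _ fun z => sq_nonneg _)).symm
    _ ≤ ENNReal.ofReal (∫ z, (π (X z))⁻¹ * g (X z) ^ 2 ∂Q) :=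
        ENNReal.ofReal_le_ofReal h3
    _ = ∫⁻ z, ENNReal.ofReal ((π (X z))⁻¹ * g (X z) ^ 2) ∂Q :=
        ofReal_integral_eq_lintegral_ofReal hint hnn
    _ ≤ _ := hlin

theorem measurable_lintegral_weighted_sq {S D : Type*} [MeasurableSpace S] [MeasurableSpace D]
    {Q : Measure D} [IsFiniteMeasure Q] {w : D → ℝ} (hw : Measurable w) {g : S → D → ℝ}
    (hg : Measurable fun q : S × D => g q.1 q.2) :
    Measurable fun s => ∫⁻ z, ENNReal.ofReal (w z * g s z ^ 2) ∂Q := by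
  have hf : Measurable fun q : S × D => ENNReal.ofReal (w q.2 * g q.1 q.2 ^ 2) :=
    ((hw.comp measurable_snd).mul (hg.pow_const 2)).ennreal_ofReal
  exact hf.lintegral_prod_right'

/-- The remainder of a fold exceeds `M c / √(n a)` only if the weighted error of the fold's
regression estimator exceeds `M₁ c²`, or else with probability at most `M₁ / M²`. -/
theorem measure_foldRemainder_le {p n K : ℕ} {Q : Measure (DataPoint p)} [IsProbabilityMeasure Q]
    {π μ : (Fin p → ℝ) → ℝ} {mhat : Learner p n} {Ω : Type*} [MeasurableSpace Ω] {P : Measure Ω}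
    [IsProbabilityMeasure P] {Z : Fin n → Ω → DataPoint p} {fold : Ω → Fin n → Fin K}
    (hs : IsFoldedSample P Q Z fold) (h : IsPropensity Q π) (ha : 0 < effRate Q π)
    (hμ : Measurable μ)
    (hmhat : ∀ J : Finset (Fin n), Measurable
      (fun q : (J → DataPoint p) × (Fin p → ℝ) => mhat J q.1 q.2))
    (hn : 0 < n) (k : Fin K) {M M₁ c : ℝ} (hM : 0 < M) (hM₁ : 0 < M₁) (hc : 0 ≤ c) :
    P {ω | ENNReal.ofReal (M * (c / √(n * effRate Q π))) <
        ‖foldRemainder π μ mhat (fold ω) (fun i => Z i ω) k‖ₑ} ≤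
      P {ω | ENNReal.ofReal (M₁ * c ^ 2) < ∫⁻ z, ENNReal.ofReal (effRate Q π / π (X z) *
        (mhatOut mhat (fold ω) (fun i => Z i ω) k (X z) - μ (X z)) ^ 2) ∂Q} +
      ENNReal.ofReal (M₁ / M ^ 2) := by
  set a := effRate Q π with ha_def
  have hn' : (0 : ℝ) < n := by exact_mod_cast hn
  let g : ∀ J : Finset (Fin n), (J → DataPoint p) → (Fin p → ℝ) → ℝ :=
    fun J s x => mhat J (fun j => observed (s j)) x - μ x
  let W : ∀ J : Finset (Fin n), (J → DataPoint p) → ℝ≥0∞ :=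
    fun J s => ∫⁻ z, ENNReal.ofReal (a / π (X z) * g J s (X z) ^ 2) ∂Q
  -- the summand is truncated to training data with a small error, so that its moments exist
  let T : ∀ J : Finset (Fin n), Set ((J → DataPoint p) × DataPoint p) :=
    fun J => {q | W J q.1 ≤ ENNReal.ofReal (M₁ * c ^ 2)}
  let f : ∀ J : Finset (Fin n), (J → DataPoint p) → DataPoint p → ℝ := fun J s z =>
    (T J).indicator (fun q => (1 - R q.2 / π (X q.2)) * g J q.1 (X q.2)) (s, z)
  have hf1 : ∀ J s, W J s ≤ ENNReal.ofReal (M₁ * c ^ 2) →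
      ∀ z, f J s z = (1 - R z / π (X z)) * g J s (X z) :=
    fun J s hJs z => Set.indicator_of_mem (s := T J) (a := (s, z)) hJs _
  have hf0 : ∀ J s, ¬ W J s ≤ ENNReal.ofReal (M₁ * c ^ 2) → ∀ z, f J s z = 0 :=
    fun J s hJs z => Set.indicator_of_notMem (s := T J) (a := (s, z)) hJs _
  have hπX : Measurable fun z : DataPoint p => π (X z) := h.measurable.comp measurable_X
  have hgm : ∀ J : Finset (Fin n), Measurable fun q : (J → DataPoint p) × DataPoint p =>
      g J q.1 (X q.2) :=
    fun J => (measurable_learner_comp hmhat J).sub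
      (hμ.comp (measurable_X.comp measurable_snd))
  have hgx : ∀ J s, Measurable (g J s) := fun J s =>
    ((hmhat J).comp (measurable_const.prodMk measurable_id)).sub hμ
  have hWm : ∀ J, Measurable (W J) := fun J =>
    measurable_lintegral_weighted_sq (hπX.const_div a) (hgm J)
  have hfm : ∀ J, Measurable (Function.uncurry (f J)) := fun J => by
    have hT : MeasurableSet (T J) :=
      measurableSet_le ((hWm J).comp measurable_fst) measurable_const
    have hu : Measurable fun q : (J → DataPoint p) × DataPoint p =>
        (1 - R q.2 / π (X q.2)) * g J q.1 (X q.2) :=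
      (measurable_const.sub ((measurable_R.div hπX).comp measurable_snd)).mul (hgm J)
    exact hu.indicator hT
  have hmom : ∀ J s, MemLp (f J s) 2 Q ∧ ∫ z, f J s z ∂Q = 0 ∧
      ∫⁻ z, ‖f J s z‖ₑ ^ 2 ∂Q ≤ ENNReal.ofReal (M₁ * c ^ 2 / a) := by
    intro J s
    by_cases hJs : W J s ≤ ENNReal.ofReal (M₁ * c ^ 2)
    · have hfJ : f J s = fun z => (1 - R z / π (X z)) * g J s (X z) := funext (hf1 J s hJs)
      rw [hfJ]
      exact h.ipw_moments_of_lintegral_le ha (hgx J s) hJs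
    · have hfJ : f J s = fun _ => 0 := funext (hf0 J s hJs)
      rw [hfJ]
      exact ⟨MemLp.zero', by simp, by simp⟩
  have hcf := lintegral_sq_sum_crossfit_le (h := f) hs.measurable hs.law hs.indep hs.measurable_fold
    hs.indep_fold (fun φ => trainIdx φ k) hfm (fun J s => (hmom J s).1)
    (fun J s => (hmom J s).2.1) (fun J s => (hmom J s).2.2)
  have hmeas : Measurable fun ω => ∑ i ∈ (trainIdx (fold ω) k)ᶜ,
      f (trainIdx (fold ω) k) (fun j => Z j ω) (Z i ω) :=
    (measurable_sum_compl (ι := Fin n) (D := DataPoint p) (Φ := Fin n → Fin K)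
      (fun φ => trainIdx φ k) (h := f) hfm).comp
      (f := fun ω => (fold ω, fun i => Z i ω))
      (hs.measurable_fold.prodMk (measurable_pi_lambda _ hs.measurable))
  let S : Ω → ℝ := fun ω => (n : ℝ)⁻¹ * ∑ i ∈ (trainIdx (fold ω) k)ᶜ,
      f (trainIdx (fold ω) k) (fun j => Z j ω) (Z i ω)
  have hSm : AEMeasurable (fun ω => ‖S ω‖ₑ) P := (hmeas.const_mul _).enorm.aemeasurable
  have hS2 : ∫⁻ ω, ‖S ω‖ₑ ^ 2 ∂P ≤ ENNReal.ofReal (M₁ * (c / √(n * a)) ^ 2) := by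
    simp only [S, enorm_mul, mul_pow]
    rw [lintegral_const_mul _ (hmeas.enorm.pow_const 2)]
    refine (mul_le_mul_right hcf _).trans (le_of_eq ?_)
    rw [Real.enorm_of_nonneg (by positivity), Fintype.card_fin, ← ENNReal.ofReal_natCast,
      ← ENNReal.ofReal_pow (by positivity), ← ENNReal.ofReal_mul (by positivity),
      ← ENNReal.ofReal_mul (by positivity), div_pow, Real.sq_sqrt (by positivity)]
    congr 1
    field_simp
  have hmarkov := measure_rate_lt_le_of_lintegral_sq hSm hM
    (show 0 ≤ c / √(n * a) by positivity) hS2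
  have hsub : {ω | ENNReal.ofReal (M * (c / √(n * a))) <
      ‖foldRemainder π μ mhat (fold ω) (fun i => Z i ω) k‖ₑ} ⊆
      {ω | ENNReal.ofReal (M₁ * c ^ 2) < W (trainIdx (fold ω) k) (fun j => Z j ω)} ∪
        {ω | ENNReal.ofReal (M * (c / √(n * a))) < ‖S ω‖ₑ} := by
    intro ω hω
    by_cases hW : W (trainIdx (fold ω) k) (fun j => Z j ω) ≤ ENNReal.ofReal (M₁ * c ^ 2)
    · refine .inr ?_
      have e : S ω = foldRemainder π μ mhat (fold ω) (fun i => Z i ω) k := by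
        simp only [S, hf1 _ _ hW, foldRemainder, g, mhatOut]
      change _ < ‖S ω‖ₑ
      rw [e]
      exact hω
    · exact .inl (not_le.1 hW)
  calc _ ≤ _ := measure_mono hsub
    _ ≤ _ := measure_union_le _ _
    _ ≤ _ := add_le_add le_rfl hmarkov

theorem IsBigOp.of_mean_iid {p : ℕ → ℕ} {Q : ∀ N, Measure (DataPoint (p N))}
    [∀ N, IsProbabilityMeasure (Q N)] {Ω : ℕ → Type*} [∀ N, MeasurableSpace (Ω N)]
    {P : ∀ N, Measure (Ω N)} [∀ N, IsProbabilityMeasure (P N)]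
    {Z : ∀ N, Fin N → Ω N → DataPoint (p N)} (hZ : ∀ N i, Measurable (Z N i))
    (hlaw : ∀ N i, (P N).map (Z N i) = Q N) (hindep : ∀ N, iIndepFun (Z N) (P N))
    {g : ∀ N, DataPoint (p N) → ℝ} (hgm : ∀ N, Measurable (g N)) {r : ℕ → ℝ} (hr : ∀ N, 0 ≤ r N)
    {B : ℝ} (hB : 0 ≤ B)
    (hg : ∀ᶠ N : ℕ in atTop, MemLp (g N) 2 (Q N) ∧ ∫ z, g N z ∂(Q N) = 0 ∧
      ∫ z, g N z ^ 2 ∂(Q N) ≤ B * (N * r N ^ 2)) :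
    IsBigOp P (fun N ω => ‖(N : ℝ)⁻¹ * ∑ i, g N (Z N i ω)‖ₑ) r := by
  have hm : ∀ N, Measurable fun ω => ∑ i, g N (Z N i ω) := fun N =>
    Finset.measurable_sum _ fun i _ => (hgm N).comp (hZ N i)
  refine IsBigOp.of_lintegral_sq hB hr
    (.of_forall fun N => ((hm N).const_mul _).enorm.aemeasurable) ?_
  filter_upwards [hg, eventually_gt_atTop 0] with N ⟨h2, h0, hle⟩ hN
  have hN' : (0 : ℝ) < N := by exact_mod_cast hN
  have hsq : ∫⁻ z, ‖g N z‖ₑ ^ 2 ∂(Q N) = ENNReal.ofReal (∫ z, g N z ^ 2 ∂(Q N)) := by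
    rw [ofReal_integral_eq_lintegral_ofReal h2.integrable_sq (ae_of_all _ fun z => sq_nonneg _)]
    refine lintegral_congr fun z => ?_
    rw [← ofReal_norm, ← ENNReal.ofReal_pow (norm_nonneg _), Real.norm_eq_abs, sq_abs]
  simp only [enorm_mul, mul_pow]
  rw [lintegral_const_mul _ ((hm N).enorm.pow_const 2),
    lintegral_sq_sum_iid (hZ N) (hlaw N) (hindep N) (hgm N) h2 h0, hsq,
    Real.enorm_of_nonneg (by positivity), Fintype.card_fin, ← ENNReal.ofReal_natCast,
    ← ENNReal.ofReal_pow (by positivity), ← ENNReal.ofReal_mul (by positivity),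
    ← ENNReal.ofReal_mul (by positivity)]
  refine ENNReal.ofReal_le_ofReal ?_
  calc ((N : ℝ)⁻¹) ^ 2 * (N * ∫ z, g N z ^ 2 ∂(Q N))
      ≤ ((N : ℝ)⁻¹) ^ 2 * (N * (B * (N * r N ^ 2))) := by gcongr
    _ = B * r N ^ 2 := by field_simp

/-! ### Asymptotic expansions and normality -/

/-- The two influence functions differ by the centred regression function. -/
theorem OutcomeBounds.psi_sub_psiTilde {p : ℕ} {Q : Measure (DataPoint p)}
    [IsProbabilityMeasure Q] {π μ : (Fin p → ℝ) → ℝ} {σ₁ σ₂ : ℝ} (hb : OutcomeBounds Q μ σ₁ σ₂)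
    (h : IsPropensity Q π) (ha : 0 < effRate Q π) (z : DataPoint p) :
    psi Q π μ z - psiTilde Q π μ z = μ (X z) - ∫ z', μ (X z') ∂Q := by
  rw [psi, psiTilde, hb.integral_ipw_residual h ha, integral_sub
    (hb.memLp_Y.integrable (by norm_num)) (hb.memLp_regression.integrable (by norm_num)),
    meanOutcome]
  ring

theorem IsBigOp.of_foldRemainder {p : ℕ → ℕ} {Q : ∀ N, Measure (DataPoint (p N))}
    [∀ N, IsProbabilityMeasure (Q N)] {π μ : ∀ N, (Fin (p N) → ℝ) → ℝ}
    {mhat : ∀ N, Learner (p N) N} {Ω : ℕ → Type*} [∀ N, MeasurableSpace (Ω N)]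
    {P : ∀ N, Measure (Ω N)} [∀ N, IsProbabilityMeasure (P N)]
    {Z : ∀ N, Fin N → Ω N → DataPoint (p N)} {K : ℕ} {fold : ∀ N, Ω N → Fin N → Fin K}
    (hs : ∀ N, IsFoldedSample (P N) (Q N) (Z N) (fold N)) (h : ∀ N, IsPropensity (Q N) (π N))
    (ha : ∀ᶠ N in atTop, 0 < effRate (Q N) (π N)) (hμ : ∀ N, Measurable (μ N))
    (hmhat : ∀ N (J : Finset (Fin N)), Measurable
      (fun q : (J → DataPoint (p N)) × (Fin (p N) → ℝ) => mhat N J q.1 q.2))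
    {c : ℕ → ℝ} (hc : ∀ N, 0 ≤ c N) (k : Fin K)
    (hcμ : IsBigOp P
      (fun N ω => ∫⁻ z, ENNReal.ofReal (effRate (Q N) (π N) / π N (X z) *
        (mhatOut (mhat N) (fold N ω) (fun i => Z N i ω) k (X z) - μ N (X z)) ^ 2) ∂(Q N))
      (fun N => c N ^ 2)) :
    IsBigOp P (fun N ω => ‖foldRemainder (π N) (μ N) (mhat N) (fold N ω) (fun i => Z N i ω) k‖ₑ)
      (fun N => c N / √(N * effRate (Q N) (π N))) := by
  intro ε hε
  obtain ⟨M₁, hM₁, hev⟩ := hcμ (ε / 2) (by positivity)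
  -- this choice of `M` gives `M₁ / M ^ 2 ≤ ε / 2`
  refine ⟨√(2 * M₁ / ε), by positivity, ?_⟩
  filter_upwards [hev, ha, eventually_gt_atTop 0] with N hN haN hN0
  refine (measure_foldRemainder_le (hs N) (h N) haN (hμ N) (hmhat N) hN0 k (by positivity) hM₁
    (hc N)).trans ?_
  have hM : M₁ / √(2 * M₁ / ε) ^ 2 = ε / 2 := by
    rw [Real.sq_sqrt (by positivity)]
    field_simp
  rw [hM]
  refine (add_le_add hN le_rfl).trans (le_of_eq ?_)
  rw [← ENNReal.ofReal_add (by positivity) (by positivity), add_halves]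

theorem mainTheorem2
    -- for each sample size `N`: the covariate dimension, the law of `(R, Y, X)`, the propensity
    -- score and the limit of the outcome estimators
    (p : ℕ → ℕ)
    (Q : ∀ N, Measure (DataPoint (p N))) [∀ N, IsProbabilityMeasure (Q N)]
    (π μ : ∀ N, (Fin (p N) → ℝ) → ℝ)
    (hπ_meas : ∀ N, Measurable (π N)) (hμ_meas : ∀ N, Measurable (μ N))
    -- `π_N(X) = E[R | X]`
    (hπ : ∀ N, (fun z => π N (X z)) =ᵐ[Q N] (Q N)[R | sigmaX (p N)])
    -- ignorability
    (hMAR : ∀ N, CondIndepFun (sigmaX (p N)) (measurable_X.comap_le) R Y (Q N))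
    -- finite second moments and positive definite `Var(X)`
    (hY2 : ∀ N, MemLp Y 2 (Q N)) (hX2 : ∀ N, MemLp X 2 (Q N))
    (hCov : ∀ N, (Matrix.of fun i j : Fin (p N) =>
      cov[fun z => X z i, fun z => X z j; Q N]).PosDef)
    -- `E[(Y - m(X))² | X] ≥ σ₁² > 0`, `E[(Y - μ(X))² | X] ≤ σ₂²`, `Var(Y) ≤ σ₂²`
    (σ₁ σ₂ : ℝ) (hσ₁ : 0 < σ₁)
    (hlow : ∀ N, ∀ᵐ z ∂(Q N), σ₁ ^ 2 ≤
      ((Q N)[fun z' => (Y z' - ((Q N)[Y | sigmaX (p N)]) z') ^ 2 | sigmaX (p N)]) z)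
    (hint : ∀ N, Integrable (fun z => (Y z - μ N (X z)) ^ 2) (Q N))
    (hup : ∀ N, ∀ᵐ z ∂(Q N),
      ((Q N)[fun z' => (Y z' - μ N (X z')) ^ 2 | sigmaX (p N)]) z ≤ σ₂ ^ 2)
    (hVarY : ∀ N, Var[Y; Q N] ≤ σ₂ ^ 2)
    -- `N a_N → ∞`
    (hNa : Tendsto (fun N : ℕ => (N : ℝ) * effRate (Q N) (π N)) atTop atTop)
    -- the sample, i.i.d. from `Q N`, and an independent random partition into `K ≥ 2` folds
    (Ω : ℕ → Type*) [∀ N, MeasurableSpace (Ω N)]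
    (P : ∀ N, Measure (Ω N)) [∀ N, IsProbabilityMeasure (P N)]
    (Z : ∀ N, Fin N → Ω N → DataPoint (p N))
    (hZ_meas : ∀ N i, Measurable (Z N i)) (hZ_law : ∀ N i, (P N).map (Z N i) = Q N)
    (hZ_indep : ∀ N, iIndepFun (Z N) (P N))
    (K : ℕ) (_hK : 2 ≤ K) (fold : ∀ N, Ω N → Fin N → Fin K)
    (hfold_meas : ∀ N, Measurable (fold N))
    (hfold_indep : ∀ N, IndepFun (fold N) (fun ω i => Z N i ω) (P N))
    -- the learning method for the outcome model
    (mhat : ∀ N, Learner (p N) N)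
    (hmhat_meas : ∀ N (J : Finset (Fin N)), Measurable
      (fun q : (J → DataPoint (p N)) × (Fin (p N) → ℝ) => mhat N J q.1 q.2))
    -- `E_X[a_N / π_N(X) * (m̂(X; S_{-k}) - μ(X))²] = O_p(c_N²)` with `c_N = o(1)`
    (c : ℕ → ℝ) (hc_nonneg : ∀ N, 0 ≤ c N) (hc : Tendsto c atTop (𝓝 0))
    (hcμ : ∀ k : Fin K, IsBigOp P
      (fun N ω => ∫⁻ z, ENNReal.ofReal (effRate (Q N) (π N) / π N (X z) *
        (mhatOut (mhat N) (fold N ω) (fun i => Z N i ω) k (X z) - μ N (X z)) ^ 2) ∂(Q N))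
      (fun N => c N ^ 2)) :
    let a : ℕ → ℝ := fun N => effRate (Q N) (π N)
    let err : ∀ N, Ω N → ℝ := fun N ω =>
      thetaTilde (π N) (mhat N) (fold N ω) (fun i => Z N i ω) - meanOutcome (Q N)
    let V : ℕ → ℝ := fun N => Var[psi (Q N) (π N) (μ N); Q N]
    let V' : ℕ → ℝ := fun N => Var[psiTilde (Q N) (π N) (μ N); Q N]
    -- first expansion
    IsBigOp P
      (fun N ω => ‖err N ω - (N : ℝ)⁻¹ * ∑ i, psi (Q N) (π N) (μ N) (Z N i ω)‖ₑ)
      (fun N => c N / √(N * a N)) ∧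
    SameOrder V (fun N => (a N)⁻¹) ∧
    -- second expansion
    IsBigOp P
      (fun N ω => ‖err N ω - (N : ℝ)⁻¹ * ∑ i, psiTilde (Q N) (π N) (μ N) (Z N i ω)‖ₑ)
      (fun N : ℕ => c N / √(N * a N) + 1 / √N) ∧
    SameOrder V' (fun N => (a N)⁻¹) ∧
    (∀ᶠ N in atTop, Integrable (psiTilde (Q N) (π N) (μ N)) (Q N) ∧
      ∫ z, psiTilde (Q N) (π N) (μ N) z ∂(Q N) = 0) ∧
    -- rate and asymptotic normality under the tail condition
    ((∀ t : ℝ, 0 < t → Tendsto (fun N : ℕ => a N *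
        ∫ z in {z | t * √(N / a N) < |psi (Q N) (π N) (μ N) z|},
          psi (Q N) (π N) (μ N) z ^ 2 ∂(Q N)) atTop (𝓝 0)) →
      IsBigOp P (fun N ω => ‖√(N * a N) * err N ω‖ₑ) (fun _ => 1) ∧
      TendstoInDistribution (fun (N : ℕ) ω => √N * (√(V N))⁻¹ * err N ω) atTop
        (id : ℝ → ℝ) P (gaussianReal 0 1) ∧
      (Tendsto a atTop (𝓝 0) →
        TendstoInDistribution (fun (N : ℕ) ω => √N * (√(V' N))⁻¹ * err N ω) atTop
          (id : ℝ → ℝ) P (gaussianReal 0 1))) ∧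
    -- comparison of the two variances
    (Tendsto a atTop (𝓝 0) → (fun N => V N / V' N - 1) =O[atTop] a) := by
  intro a err V V'
  have hprop : ∀ N, IsPropensity (Q N) (π N) := fun N => ⟨hπ_meas N, hπ N, hMAR N⟩
  have hb : ∀ N, OutcomeBounds (Q N) (μ N) σ₁ σ₂ := fun N =>
    ⟨hμ_meas N, hY2 N, hlow N, hint N, hup N, hVarY N⟩
  have hs : ∀ N, IsFoldedSample (P N) (Q N) (Z N) (fold N) := fun N =>
    ⟨hZ_meas N, hZ_law N, hZ_indep N, hfold_meas N, hfold_indep N⟩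
  have hpos : ∀ᶠ N : ℕ in atTop, 0 < N ∧ 0 < a N := by
    filter_upwards [hNa.eventually_gt_atTop 0, eventually_gt_atTop 0] with N h1 h2
    exact ⟨h2, pos_of_mul_pos_right h1 (Nat.cast_nonneg N)⟩
  have ha0 : ∀ N, 0 ≤ a N := fun N => effRate_nonneg _ _
  have hσ₁2 : 0 < σ₁ ^ 2 := by positivity
  have hψm : ∀ N, Measurable (psi (Q N) (π N) (μ N)) := fun N =>
    (((hμ_meas N).comp measurable_X).add
      ((measurable_R.div ((hπ_meas N).comp measurable_X)).mul
        (hb N).measurable_residual)).sub_const _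
  have hVb : ∀ᶠ N in atTop, σ₁ ^ 2 * (a N)⁻¹ ≤ V N ∧ V N ≤ σ₂ ^ 2 * (a N)⁻¹ :=
    hpos.mono fun N hN => (hb N).variance_psi_bounds (hprop N) hN.2
  have hVb' : ∀ᶠ N in atTop, σ₁ ^ 2 * (a N)⁻¹ ≤ V' N ∧ V' N ≤ σ₂ ^ 2 * (a N)⁻¹ :=
    hpos.mono fun N hN => (hb N).variance_psiTilde_bounds (hprop N) hN.2
  have hVint : ∀ᶠ N in atTop, ∫ z, psi (Q N) (π N) (μ N) z ^ 2 ∂(Q N) = V N := by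
    filter_upwards [hpos] with N hN
    exact (variance_of_integral_eq_zero (hψm N).aemeasurable
      ((hb N).integral_psi (hprop N) hN.2)).symm
  have hVO : (fun N => V N / V' N - 1) =O[atTop] a := by
    refine IsBigO.of_bound (σ₂ ^ 2 / σ₁ ^ 2) ?_
    filter_upwards [hpos, hVb'] with N hN hV'
    have hinv : 0 < (a N)⁻¹ := inv_pos.2 hN.2
    have hV'pos : 0 < V' N := lt_of_lt_of_le (by positivity) hV'.1
    have hdiff := (hb N).abs_variance_psi_sub_variance_psiTilde_le (hprop N) hN.2
    rw [Real.norm_of_nonneg (ha0 N), Real.norm_eq_abs, div_sub_one hV'pos.ne', abs_div,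
      abs_of_pos hV'pos, div_le_iff₀ hV'pos]
    refine hdiff.trans ?_
    calc σ₂ ^ 2 = σ₂ ^ 2 / σ₁ ^ 2 * a N * (σ₁ ^ 2 * (a N)⁻¹) := by
          have := hN.2.ne'
          field_simp
      _ ≤ _ := mul_le_mul_of_nonneg_left hV'.1 (mul_nonneg (by positivity) (ha0 N))
  have hsame : ∀ U : ℕ → ℝ, (∀ᶠ N in atTop, σ₁ ^ 2 * (a N)⁻¹ ≤ U N ∧ U N ≤ σ₂ ^ 2 * (a N)⁻¹) →
      SameOrder U (fun N => (a N)⁻¹) := by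
    intro U hU
    refine ⟨σ₁ ^ 2 / 2, σ₂ ^ 2 + 1, by positivity, by positivity, ?_⟩
    filter_upwards [hU, hpos] with N h1 h2
    have hinv : 0 < (a N)⁻¹ := inv_pos.2 h2.2
    constructor <;> nlinarith
  have hrate : ∀ N : ℕ, 0 ≤ c N / √(N * a N) := fun N =>
    div_nonneg (hc_nonneg N) (Real.sqrt_nonneg _)
  have hexp1 : IsBigOp P
      (fun N ω => ‖err N ω - (N : ℝ)⁻¹ * ∑ i, psi (Q N) (π N) (μ N) (Z N i ω)‖ₑ)
      (fun N => c N / √(N * a N)) := by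
    have hsum := IsBigOp.finset_sum Finset.univ hrate fun k _ =>
      IsBigOp.of_foldRemainder hs hprop (hpos.mono fun _ h => h.2) hμ_meas hmhat_meas hc_nonneg k
        (hcμ k)
    refine hsum.mono ?_ one_pos (.of_forall fun N => (one_mul _).ge)
    filter_upwards [hpos] with N hN ω
    simp only [err]
    rw [thetaTilde_sub_mean_psi_eq hN.1]
    exact enorm_sum_le _ _
  have hmean : IsBigOp P (fun N ω => ‖(N : ℝ)⁻¹ * ∑ i, psi (Q N) (π N) (μ N) (Z N i ω)‖ₑ)
      (fun N => 1 / √(N * a N)) := by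
    refine IsBigOp.of_mean_iid hZ_meas hZ_law hZ_indep hψm (fun N => by positivity)
      (sq_nonneg σ₂) ?_
    filter_upwards [hpos, hVb, hVint] with N hN hV hVi
    have hN' : (0 : ℝ) < N := by exact_mod_cast hN.1
    refine ⟨(hb N).memLp_psi (hprop N) hN.2, (hb N).integral_psi (hprop N) hN.2, ?_⟩
    rw [hVi, div_pow, Real.sq_sqrt (mul_nonneg hN'.le (ha0 N))]
    refine hV.2.trans (le_of_eq ?_)
    have := hN.2.ne'
    field_simp
  have hexp2 : IsBigOp P
      (fun N ω => ‖err N ω - (N : ℝ)⁻¹ * ∑ i, psiTilde (Q N) (π N) (μ N) (Z N i ω)‖ₑ)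
      (fun N : ℕ => c N / √(N * a N) + 1 / √N) := by
    have hdiff : IsBigOp P (fun N ω => ‖(N : ℝ)⁻¹ *
        ∑ i, (μ N (X (Z N i ω)) - ∫ z, μ N (X z) ∂(Q N))‖ₑ) (fun N : ℕ => 1 / √N) := by
      refine IsBigOp.of_mean_iid (g := fun N z => μ N (X z) - ∫ z', μ N (X z') ∂(Q N))
        hZ_meas hZ_law hZ_indep (fun N => ((hμ_meas N).comp measurable_X).sub_const _)
        (fun N => by positivity) (show 0 ≤ 4 * σ₂ ^ 2 by positivity) ?_
      filter_upwards [hpos] with N hN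
      have hN' : (0 : ℝ) < N := by exact_mod_cast hN.1
      have hL := (hb N).memLp_regression
      have hvar := (hb N).variance_regression_le
      rw [variance_eq_integral hL.aestronglyMeasurable.aemeasurable] at hvar
      refine ⟨hL.sub (memLp_const _), ?_, hvar.trans (le_of_eq ?_)⟩
      · rw [integral_sub (hL.integrable (by norm_num)) (integrable_const _)]
        simp
      · rw [div_pow, Real.sq_sqrt hN'.le]
        field_simp
    refine (hexp1.add hdiff hrate fun N => by positivity).mono ?_ one_pos
      (.of_forall fun N => (one_mul _).ge)
    filter_upwards [hpos] with N hN ω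
    have hpt : ∑ i, (μ N (X (Z N i ω)) - ∫ z, μ N (X z) ∂(Q N)) =
        ∑ i, psi (Q N) (π N) (μ N) (Z N i ω) - ∑ i, psiTilde (Q N) (π N) (μ N) (Z N i ω) := by
      rw [← Finset.sum_sub_distrib]
      exact Finset.sum_congr rfl fun i _ =>
        ((hb N).psi_sub_psiTilde (hprop N) hN.2 (Z N i ω)).symm
    rw [hpt]
    refine le_trans (le_of_eq ?_) (enorm_add_le _ _)
    congr 1
    ring
  have hrootN : IsBigOp P (fun N ω => ‖√(N * a N) * err N ω‖ₑ) (fun _ => 1) := by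
    refine (hexp1.add hmean hrate fun N => by positivity).of_le_mul
      (s := fun N => √(N * a N)) two_pos (.of_forall fun N => Real.sqrt_nonneg _)
      (.of_forall fun N ω => ?_) ?_
    · rw [enorm_mul, Real.enorm_of_nonneg (Real.sqrt_nonneg _)]
      gcongr
      refine le_trans (le_of_eq ?_) (enorm_add_le _ _)
      rw [sub_add_cancel]
    · filter_upwards [hpos, hc.eventually_lt_const one_pos] with N hN hcN
      have hN' : (0 : ℝ) < N := by exact_mod_cast hN.1
      have hsq : 0 < √(N * a N) := Real.sqrt_pos.2 (mul_pos hN' hN.2)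
      have : √(N * a N) * (c N / √(N * a N) + 1 / √(N * a N)) = c N + 1 := by field_simp
      rw [this]
      linarith
  have herrm : ∀ N, Measurable (err N) := fun N =>
    ((measurable_thetaTilde (K := K) (hπ_meas N) (hmhat_meas N)).comp
      (f := fun ω => (fold N ω, fun i => Z N i ω))
      ((hfold_meas N).prodMk (measurable_pi_lambda _ (hZ_meas N)))).sub_const _
  -- asymptotic normality, with any normalization that is asymptotically equivalent to `V`
  have hclt : (∀ t : ℝ, 0 < t → Tendsto (fun N : ℕ => a N *
        ∫ z in {z | t * √(N / a N) < |psi (Q N) (π N) (μ N) z|},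
          psi (Q N) (π N) (μ N) z ^ 2 ∂(Q N)) atTop (𝓝 0)) →
      ∀ w : ℕ → ℝ, (∀ᶠ N in atTop, σ₁ ^ 2 * (a N)⁻¹ ≤ w N) →
        Tendsto (fun N => V N / w N) atTop (𝓝 1) →
        TendstoInDistribution (fun (N : ℕ) ω => √N * (√(w N))⁻¹ * err N ω) atTop
          (id : ℝ → ℝ) P (gaussianReal 0 1) := by
    intro htail w hw hVw
    have hwpos : ∀ᶠ N in atTop, 0 < w N := by
      filter_upwards [hw, hpos] with N h1 h2
      exact lt_of_lt_of_le (mul_pos hσ₁2 (inv_pos.2 h2.2)) h1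
    refine tendstoInDistribution_of_lindeberg hZ_meas hZ_law hZ_indep hψm
      (hpos.mono fun N hN => (hb N).memLp_psi (hprop N) hN.2)
      (hpos.mono fun N hN => (hb N).integral_psi (hprop N) hN.2) hwpos ?_ ?_
      (fun N => ((herrm N).const_mul _).aemeasurable) ?_
    · refine hVw.congr' ?_
      filter_upwards [hVint] with N hN
      rw [hN]
    · intro δ hδ
      have hlim := (htail (δ * σ₁) (by positivity)).const_mul (σ₁ ^ 2)⁻¹
      rw [mul_zero] at hlim
      refine tendsto_of_tendsto_of_tendsto_of_le_of_le' tendsto_const_nhds hlim ?_ ?_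
      · filter_upwards [hwpos] with N hN
        exact mul_nonneg (inv_nonneg.2 hN.le) (integral_nonneg fun z => sq_nonneg _)
      · filter_upwards [hwpos, hw, hpos] with N hwN hle hN
        have hN' : (0 : ℝ) < N := by exact_mod_cast hN.1
        have hthr : δ * σ₁ * √(N / a N) ≤ δ * √(N * w N) := by
          rw [mul_assoc]
          refine mul_le_mul_of_nonneg_left (Real.le_sqrt_of_sq_le ?_) hδ.le
          rw [mul_pow, Real.sq_sqrt (div_nonneg hN'.le (ha0 N))]
          calc σ₁ ^ 2 * (N / a N) = N * (σ₁ ^ 2 * (a N)⁻¹) := by ring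
            _ ≤ _ := mul_le_mul_of_nonneg_left hle hN'.le
        have hmono : ∫ z in {z | δ * √(N * w N) < |psi (Q N) (π N) (μ N) z|},
              psi (Q N) (π N) (μ N) z ^ 2 ∂(Q N) ≤
            ∫ z in {z | δ * σ₁ * √(N / a N) < |psi (Q N) (π N) (μ N) z|},
              psi (Q N) (π N) (μ N) z ^ 2 ∂(Q N) :=
          setIntegral_mono_set ((hb N).memLp_psi (hprop N) hN.2).integrable_sq.integrableOn
            (ae_of_all _ fun z => sq_nonneg _)
            (Eventually.of_forall fun z hz => lt_of_le_of_lt hthr hz)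
        have hinv : (w N)⁻¹ ≤ (σ₁ ^ 2)⁻¹ * a N := by
          have := inv_anti₀ (mul_pos hσ₁2 (inv_pos.2 hN.2)) hle
          rwa [mul_inv, inv_inv] at this
        rw [← mul_assoc]
        exact mul_le_mul hinv hmono (integral_nonneg fun z => sq_nonneg _)
          (mul_nonneg (inv_nonneg.2 hσ₁2.le) (ha0 N))
    · intro δ hδ
      have hrem : IsBigOp P (fun N ω => ‖√N * (√(w N))⁻¹ * err N ω -
          (√(N * w N))⁻¹ * ∑ i, psi (Q N) (π N) (μ N) (Z N i ω)‖ₑ) c := by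
        refine hexp1.of_le_mul (s := fun N : ℕ => √N * (√(w N))⁻¹) (C := σ₁⁻¹) (by positivity)
          (.of_forall fun N => by positivity) ?_ ?_
        · filter_upwards [hpos] with N hN ω
          have hN' : (0 : ℝ) < N := by exact_mod_cast hN.1
          rw [← Real.enorm_of_nonneg (show 0 ≤ √N * (√(w N))⁻¹ by positivity), ← enorm_mul]
          refine le_of_eq (congrArg _ ?_)
          have hsq : (√(N * w N))⁻¹ = √N * (√(w N))⁻¹ * (N : ℝ)⁻¹ := by
            rw [Real.sqrt_mul hN'.le, mul_inv]
            have h1 : (√(N : ℝ))⁻¹ = √N * (N : ℝ)⁻¹ := by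
              rw [← div_eq_mul_inv, Real.sqrt_div_self]
            rw [h1]
            ring
          rw [hsq]
          ring
        · filter_upwards [hpos, hw, hwpos] with N hN hle hwN
          have hN' : (0 : ℝ) < N := by exact_mod_cast hN.1
          have hsa : 0 < √(a N) := Real.sqrt_pos.2 hN.2
          have hsw : σ₁ ≤ √(w N) * √(a N) := by
            rw [← Real.sqrt_mul hwN.le]
            refine Real.le_sqrt_of_sq_le ?_
            calc σ₁ ^ 2 = σ₁ ^ 2 * (a N)⁻¹ * a N := by field_simp [hN.2.ne']
              _ ≤ _ := mul_le_mul_of_nonneg_right hle (ha0 N)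
          have hsN : 0 < √(N : ℝ) := Real.sqrt_pos.2 hN'
          have e : √N * (√(w N))⁻¹ * (c N / √(N * a N)) = (√(w N) * √(a N))⁻¹ * c N := by
            rw [Real.sqrt_mul hN'.le]
            field_simp
          rw [e]
          exact mul_le_mul_of_nonneg_right (inv_anti₀ hσ₁ hsw) (hc_nonneg N)
      refine (hrem.tendsto_measure_zero hc hδ).congr fun N => ?_
      congr 1
      ext ω
      simp only [Set.mem_ofPred_eq]
      rw [← ofReal_norm, Real.norm_eq_abs, ENNReal.ofReal_lt_ofReal_iff_of_nonneg hδ.le]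
  refine ⟨hexp1, hsame V hVb, hexp2, hsame V' hVb', ?_, fun htail => ⟨hrootN, ?_, fun ha => ?_⟩,
    fun _ => hVO⟩
  · filter_upwards [hpos] with N hN
    exact ⟨((hb N).memLp_psiTilde (hprop N) hN.2).integrable (by norm_num),
      (hb N).integral_psiTilde (hprop N) hN.2⟩
  · refine hclt htail V (hVb.mono fun N h => h.1) (tendsto_const_nhds.congr' ?_)
    filter_upwards [hVb, hpos] with N h1 h2
    exact (div_self (lt_of_lt_of_le (mul_pos hσ₁2 (inv_pos.2 h2.2)) h1.1).ne').symm
  · refine hclt htail V' (hVb'.mono fun N h => h.1) ?_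
    simpa using (hVO.trans_tendsto ha).add_const 1
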